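/- Let $A(x)=a_dx^d+\dots+a_1x+a_0\in\mathbb{Z}[x]$ be a primitive polynomial of degree $d$ with $a_0\neq 0$, let $m>d$, and let $p$ be a prime with $p$-adic valuation $v_p$. Let $\Lambda_m\subseteq\mathbb{Z}^m$ be the $\mathbb{Z}$-module of the vectors $(v_1,\dots,v_m)$ such that $a_0v_i+a_1v_{i+1}+\dots+a_dv_{i+d}=0$ for $1\le i\le m-d$, and let $\Lambda_m^{(p)}=\Lambda_m\otimes_{\mathbb{Z}}\mathbb{Z}_p$, whose elements have coordinates in $\mathbb{Z}_p$ (the $j$-th coordinate of $v\otimes x$ is $xv_j$). The Newton polygon of $A$ at $p$ is the lower boundary of the convex hull of the points $(i,v_p(a_i))$, $0\le i\le d$, $a_i\ne0$. Let $0=w_0<w_1<\dots<w_r=d$ be the abscissae of its vertices, and for $1\le k\le r$ let $\ell_k=w_k-w_{k-1}$ and $\sigma_k=(v_p(a_{w_k})-v_p(a_{w_{k-1}}))/\ell_k$ be the length (of the horizontal projection) and the slope of its $k$-th edge, so that $\sigma_1<\dots<\sigma_r$. Let $s$ be the smallest index with $\sigma_s\ge 0$, with $s=r+1$ if there is none.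 Then there is a unique (ordered) basis of the $\mathbb{Z}_p$-module $\Lambda_m^{(p)}$ such that the $d\times m$ matrix $M=(M_{i,j})$ with the basis vectors as rows satisfies the following. 1. The left submatrix $(M_{i,j})_{1\le i\le d,\,1\le j\le d}$ is block upper triangular with diagonal blocks $B_1,\dots,B_r$, and the right submatrix $(M_{i,j})_{1\le i\le d,\,m-d+1\le j\le m}$ is block lower triangular with diagonal blocks $C_1,\dots,C_r$, where $B_k$ and $C_k$ are square of size $\ell_k$ for each $k$. 2. $B_1,\dots,B_{s-1},C_s,\dots,C_r$ are identity matrices; for $1\le k\le s-1$ the determinant of $C_k$ has valuation $-\sigma_k\ell_k(m-d)$, and for $s\le k\le r$ the determinant of $B_k$ has valuation $\sigma_k\ell_k(m-d)$. 3. For $1\le k\le s-1$, $w_{k-1}<j\le w_k$ and $0\le t\le m-j$, we have $v_p(M_{j,j+t})\ge -t\sigma_k$. For $s\le k\le r$, $w_{k-1}<j\le w_k$ and $0\le t<j+m-d$, we have $v_p(M_{j,\,j+m-d-t})\ge t\sigma_k$. The same statement holds if $s$ is instead the smallest index with $\sigma_s>0$ (with $s=r+1$ if there is none). -/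

import Mathlib

open scoped TensorProduct Polynomial

noncomputable section

/-- The `(m - d) × m` matrix, `d = deg A`, whose `i`-th row is
`0, …, 0, a₀, a₁, …, a_d, 0, …, 0` with `i` leading zeros (rows are numbered from `0`). -/
def recurrenceMatrix (A : ℤ[X]) (m : ℕ) : Matrix (Fin (m - A.natDegree)) (Fin m) ℤ :=
  Matrix.of fun i j => if (i : ℕ) ≤ (j : ℕ) then A.coeff ((j : ℕ) - (i : ℕ)) else 0

/-- The `ℤ`-module of the integral vectors of length `m` that form a linear recurrence
determined by `A`, that is, `a₀ v_i + a₁ v_{i+1} + … + a_d v_{i+d} = 0` for `0 ≤ i < m - d`. -/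
def recurrenceModule (A : ℤ[X]) (m : ℕ) : Submodule ℤ (Fin m → ℤ) :=
  LinearMap.ker (recurrenceMatrix A m).mulVecLin

/-- The `j`-th coordinate on the extension of scalars of the module of recurrences to the
`p`-adic integers; it sends `x ⊗ v` to `x v_j`. -/
def recurrenceCoord (p : ℕ) [Fact p.Prime] (A : ℤ[X]) (m : ℕ) (j : Fin m) :
    ℤ_[p] ⊗[ℤ] recurrenceModule A m →ₗ[ℤ_[p]] ℤ_[p] :=
  (TensorProduct.AlgebraTensorModule.rid ℤ ℤ_[p] ℤ_[p]).toLinearMap ∘ₗ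
    (((LinearMap.proj j : (Fin m → ℤ) →ₗ[ℤ] ℤ) ∘ₗ
      (recurrenceModule A m).subtype).baseChange ℤ_[p])

/-- The matrix whose rows are the coordinate vectors of a family of `p`-adic recurrences. -/
def rowMatrix (p : ℕ) [Fact p.Prime] (A : ℤ[X]) (m : ℕ) {ι : Type*}
    (b : ι → ℤ_[p] ⊗[ℤ] recurrenceModule A m) : Matrix ι (Fin m) ℤ_[p] :=
  Matrix.of fun i j => recurrenceCoord p A m j (b i)

/-- The convex hull of all points lying on or above one of the points `(i, v_p(a_i))`, `a_i ≠ 0`.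
The Newton polygon of `A` at `p` is its lower boundary. -/
def newtonRegion (p : ℕ) (A : ℤ[X]) : Set (ℝ × ℝ) :=
  convexHull ℝ {q : ℝ × ℝ | ∃ i : ℕ, A.coeff i ≠ 0 ∧ q.1 = (i : ℝ) ∧
    (padicValInt p (A.coeff i) : ℝ) ≤ q.2}

open Classical in
/-- The abscissae of the vertices of the Newton polygon. -/
def newtonVertices (p : ℕ) (A : ℤ[X]) : Finset ℕ :=
  A.support.filter fun i =>
    ((i : ℝ), (padicValInt p (A.coeff i) : ℝ)) ∈ (newtonRegion p A).extremePoints ℝ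

/-- The number `r` of edges of the Newton polygon. -/
def newtonEdges (p : ℕ) (A : ℤ[X]) : ℕ := (newtonVertices p A).card - 1

/-- The abscissa `w_k` of the `k`-th vertex, `0 ≤ k ≤ r`, in increasing order. -/
def newtonAbscissa (p : ℕ) (A : ℤ[X]) (k : ℕ) : ℕ :=
  Nat.nth (fun i => i ∈ newtonVertices p A) k

/-- The horizontal length of the edge from the vertex `k` to the vertex `k + 1`.
Edges are numbered from `0` to `r - 1`. -/
def newtonLength (p : ℕ) (A : ℤ[X]) (k : ℕ) : ℕ :=
  newtonAbscissa p A (k + 1) - newtonAbscissa p A k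

/-- The slope of the edge from the vertex `k` to the vertex `k + 1`. -/
def newtonSlope (p : ℕ) (A : ℤ[X]) (k : ℕ) : ℚ :=
  ((padicValInt p (A.coeff (newtonAbscissa p A (k + 1))) : ℚ) -
    (padicValInt p (A.coeff (newtonAbscissa p A k)) : ℚ)) / (newtonLength p A k : ℚ)

/-- The index of the first edge with nonnegative slope (`r` if there is none). -/
def firstNonnegEdge (p : ℕ) (A : ℤ[X]) : ℕ :=
  sInf {k : ℕ | k = newtonEdges p A ∨ (k < newtonEdges p A ∧ 0 ≤ newtonSlope p A k)}

/-- The index of the first edge with positive slope (`r` if there is none). -/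
def firstPosEdge (p : ℕ) (A : ℤ[X]) : ℕ :=
  sInf {k : ℕ | k = newtonEdges p A ∨ (k < newtonEdges p A ∧ 0 < newtonSlope p A k)}

theorem newtonAbscissa_le (p : ℕ) (A : ℤ[X]) (k : ℕ) :
    newtonAbscissa p A k ≤ A.natDegree := by
  unfold newtonAbscissa
  rcases Nat.eq_zero_or_pos (Nat.nth (fun i => i ∈ newtonVertices p A) k) with h | h
  · rw [h]; exact Nat.zero_le _
  · have hm : Nat.nth (fun i => i ∈ newtonVertices p A) k ∈ newtonVertices p A := by
      apply Nat.nth_mem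
      intro hf
      by_contra hk
      rw [Nat.nth_of_card_le hf (not_lt.mp hk)] at h
      exact lt_irrefl _ h
    classical
    exact Polynomial.le_natDegree_of_mem_supp _ (Finset.filter_subset _ _ hm)

/-- The indices `w_k, w_k + 1, …, w_{k+1} - 1` (counted from `0`) of the rows and columns that
belong to the `k`-th block. -/
def blockIndex (p : ℕ) (A : ℤ[X]) (k : ℕ) (a : Fin (newtonLength p A k)) : Fin A.natDegree :=
  ⟨newtonAbscissa p A k + a, by
    have h1 := newtonAbscissa_le p A (k + 1)
    have h2 := a.isLt
    unfold newtonLength at h2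
    omega⟩

/-- The left `d × d` submatrix of a `d × m` matrix. -/
def leftSquare {R : Type*} {d m : ℕ} (hdm : d ≤ m) (M : Matrix (Fin d) (Fin m) R) :
    Matrix (Fin d) (Fin d) R :=
  M.submatrix id (Fin.castLE hdm)

/-- The right `d × d` submatrix of a `d × m` matrix. -/
def rightSquare {R : Type*} {d m : ℕ} (hdm : d ≤ m) (M : Matrix (Fin d) (Fin m) R) :
    Matrix (Fin d) (Fin d) R :=
  M.submatrix id fun j => ⟨m - d + j, by omega⟩

/-- The block of a `d × d` matrix in block row `k` and block column `l`, when rows and columns are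
cut into intervals of the lengths of the edges of the Newton polygon. -/
def newtonBlock (p : ℕ) (A : ℤ[X]) {R : Type*} (N : Matrix (Fin A.natDegree) (Fin A.natDegree) R)
    (k l : ℕ) : Matrix (Fin (newtonLength p A k)) (Fin (newtonLength p A l)) R :=
  N.submatrix (blockIndex p A k) (blockIndex p A l)

/-- The shape of a `d × m` matrix `M` over the `p`-adic integers relative to the Newton polygon
of `A`; the blocks are numbered from `0` to `r - 1`, and the blocks with index smaller than `s`
are treated as blocks of the left type. -/
structure HasNewtonShape (p : ℕ) [Fact p.Prime] (A : ℤ[X]) {m : ℕ} (hm : A.natDegree ≤ m)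
    (s : ℕ) (M : Matrix (Fin A.natDegree) (Fin m) ℤ_[p]) : Prop where
  /-- The left square submatrix is block upper triangular. -/
  left_upper : ∀ k l : ℕ, k < newtonEdges p A → l < k →
    newtonBlock p A (leftSquare hm M) k l = 0
  /-- The right square submatrix is block lower triangular. -/
  right_lower : ∀ k l : ℕ, l < newtonEdges p A → k < l →
    newtonBlock p A (rightSquare hm M) k l = 0
  left_one : ∀ k : ℕ, k < s → newtonBlock p A (leftSquare hm M) k k = 1
  right_one : ∀ k : ℕ, s ≤ k → k < newtonEdges p A →
    newtonBlock p A (rightSquare hm M) k k = 1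
  right_det : ∀ k : ℕ, k < s →
    (newtonBlock p A (rightSquare hm M) k k).det ≠ 0 ∧
    ((newtonBlock p A (rightSquare hm M) k k).det.valuation : ℚ) =
      -newtonSlope p A k * (newtonLength p A k : ℚ) * ((m : ℚ) - (A.natDegree : ℚ))
  left_det : ∀ k : ℕ, s ≤ k → k < newtonEdges p A →
    (newtonBlock p A (leftSquare hm M) k k).det ≠ 0 ∧
    ((newtonBlock p A (leftSquare hm M) k k).det.valuation : ℚ) =
      newtonSlope p A k * (newtonLength p A k : ℚ) * ((m : ℚ) - (A.natDegree : ℚ))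
  /-- Walking `t` steps to the right from the diagonal of an identity block on the left
  (a zero entry has infinite valuation). -/
  walk_right : ∀ k : ℕ, k < s → ∀ (a : Fin (newtonLength p A k)) (t : ℕ) (c : Fin m),
    (c : ℕ) = (blockIndex p A k a : ℕ) + t →
    M (blockIndex p A k a) c ≠ 0 →
    -(t : ℚ) * newtonSlope p A k ≤ ((M (blockIndex p A k a) c).valuation : ℚ)
  /-- Walking `t` steps to the left from the diagonal of an identity block on the right. -/
  walk_left : ∀ k : ℕ, s ≤ k → k < newtonEdges p A →
    ∀ (a : Fin (newtonLength p A k)) (t : ℕ) (c : Fin m),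
    (c : ℕ) + t = (blockIndex p A k a : ℕ) + (m - A.natDegree) →
    M (blockIndex p A k a) c ≠ 0 →
    (t : ℚ) * newtonSlope p A k ≤ ((M (blockIndex p A k a) c).valuation : ℚ)

end

/-!
The basis is built one row at a time over `ℚ_[p]`. Write `d` for the degree of `A`, `w` and `w'` for
the ends of the `k`-th edge of the Newton polygon, and `σ` for its slope. The two triangularity
conditions force a row of the `k`-th block to be supported on the columns from `w` to
`w' + (m - d) - 1`. Prescribing the row on the first (or the last) `w' - w` of these columns leaves
`m - d` unknowns, and the system for them is a Toeplitz matrix with `a_{w'}` (or `a_w`) on the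
diagonal. After weighting the column `c` by `p ^ (σ c)` and the rows accordingly, the Newton polygon
says that all entries are at most as large as the diagonal ones, and strictly smaller on one side of
the diagonal. So the identity permutation dominates the Leibniz expansion (`norm_det_eq_of_upper`,
`norm_det_eq_of_lower`), the determinant has the norm of `a_{w'} ^ (m - d)`, and Cramer's rule
gives the row together with its decay (`exists_kernel_vector`, `exists_window_recurrence`). No field
extension is needed for fractional `σ`, because only real weights enter. The sign of `σ` decides at
which end the unit entry has to stand for the row to be integral.

The determinant of the other diagonal block follows from the proportionality of complementary minors
of the recurrence matrix and of a matrix of its solutions (`det_mul_det_complementary`,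
`norm_det_newtonBlock`).

Let `w` be the vertex at which the slopes change sign. On the columns `0, …, w - 1` and
`w + (m - d), …, m - 1` the rows form a unitriangular matrix, after a reordering, and a recurrence
that vanishes on these columns is zero, by the nonsingular Toeplitz matrix at `w`. Hence the rows
are a basis of the integral recurrences (`exists_basis_rowMatrix_eq`), which are the extension of
scalars of the recurrence module because `ℤ_[p]` is flat (`exists_recurrenceVector_eq_iff`).

For uniqueness, the transition matrix between two such bases is block upper triangular by the left
squares and block lower triangular by the right squares, since all diagonal blocks have nonzero
determinant; in each block one of the two squares has an identity block, so the transition matrix is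
the identity (`eq_one_of_mul_hasNewtonShape`).
-/

/-! ### Determinants over an ultrametric field -/

theorem norm_sign_mul {K : Type*} [NormedField K] {n : ℕ} (σ : Equiv.Perm (Fin n)) (x : K) :
    ‖((Equiv.Perm.sign σ : ℤ) : K) * x‖ = ‖x‖ := by
  rcases Int.units_eq_one_or (Equiv.Perm.sign σ) with h | h <;> simp [h]

section UltrametricDet

variable {K : Type*} [NormedField K] [IsUltrametricDist K]

/-- The ultrametric form of the Leibniz expansion: a bound `‖X i j‖ ≤ r i * q j` on the entries
gives the product bound on the determinant. -/
theorem norm_det_le {n : ℕ} {X : Matrix (Fin n) (Fin n) K} {r q : Fin n → ℝ}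
    (hr : ∀ i, 0 ≤ r i) (hq : ∀ i, 0 ≤ q i) (hX : ∀ i j, ‖X i j‖ ≤ r i * q j) :
    ‖X.det‖ ≤ (∏ i, r i) * ∏ i, q i := by
  rw [Matrix.det_apply']
  refine IsUltrametricDist.norm_sum_le_of_forall_le_of_nonneg
    (mul_nonneg (Finset.prod_nonneg fun i _ => hr i) (Finset.prod_nonneg fun i _ => hq i)) ?_
  intro σ _
  rw [norm_sign_mul, norm_prod]
  calc ∏ i, ‖X (σ i) i‖ ≤ ∏ i, r (σ i) * q i :=
        Finset.prod_le_prod (fun _ _ => norm_nonneg _) fun i _ => hX _ _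
    _ = _ := by rw [Finset.prod_mul_distrib, Equiv.prod_comp σ r]

theorem exists_perm_lt {n : ℕ} {σ : Equiv.Perm (Fin n)} (hσ : σ ≠ 1) : ∃ i, σ i < i := by
  by_contra! h
  apply hσ
  have h1 : ∑ i, ((σ i : Fin n) : ℕ) = ∑ i : Fin n, (i : ℕ) :=
    Equiv.sum_comp σ fun i : Fin n => (i : ℕ)
  have h2 := (Finset.sum_eq_sum_iff_of_le (s := Finset.univ)
    (f := fun i : Fin n => (i : ℕ)) (g := fun i => ((σ i : Fin n) : ℕ))
    fun i _ => Fin.le_def.mp (h i)).mp h1.symm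
  ext i
  simpa using (h2 i (Finset.mem_univ i)).symm

/-- If in addition the bound is attained on the diagonal and strict above it, then the identity
permutation dominates the Leibniz expansion. -/
theorem norm_det_eq_of_upper {n : ℕ} {X : Matrix (Fin n) (Fin n) K} {r q : Fin n → ℝ}
    (hr : ∀ i, 0 < r i) (hq : ∀ i, 0 < q i) (hX : ∀ i j, ‖X i j‖ ≤ r i * q j)
    (hd : ∀ i, ‖X i i‖ = r i * q i) (hlt : ∀ i j, i < j → ‖X i j‖ < r i * q j) :
    ‖X.det‖ = (∏ i, r i) * ∏ i, q i := by
  have hpos : 0 < (∏ i, r i) * ∏ i, q i :=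
    mul_pos (Finset.prod_pos fun i _ => hr i) (Finset.prod_pos fun i _ => hq i)
  rw [Matrix.det_apply', ← Finset.add_sum_erase _ _ (Finset.mem_univ (1 : Equiv.Perm (Fin n)))]
  have hone : ‖((Equiv.Perm.sign (1 : Equiv.Perm (Fin n)) : ℤ) : K) *
      ∏ i, X ((1 : Equiv.Perm (Fin n)) i) i‖ = (∏ i, r i) * ∏ i, q i := by
    rw [norm_sign_mul, norm_prod, ← Finset.prod_mul_distrib]
    exact Finset.prod_congr rfl fun i _ => hd i
  have hrest : ‖∑ σ ∈ Finset.univ.erase (1 : Equiv.Perm (Fin n)),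
      ((Equiv.Perm.sign σ : ℤ) : K) * ∏ i, X (σ i) i‖ < (∏ i, r i) * ∏ i, q i := by
    rcases (Finset.univ.erase (1 : Equiv.Perm (Fin n))).eq_empty_or_nonempty with h | h
    · rw [h, Finset.sum_empty, norm_zero]; exact hpos
    · obtain ⟨σ, hσ, hle⟩ := IsUltrametricDist.exists_norm_finsetSum_le_of_nonempty h
        fun σ => ((Equiv.Perm.sign σ : ℤ) : K) * ∏ i, X (σ i) i
      refine hle.trans_lt ?_
      obtain ⟨i, hi⟩ := exists_perm_lt (Finset.ne_of_mem_erase hσ)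
      rw [norm_sign_mul, norm_prod]
      have h1 : (∏ i, r i) * ∏ i, q i = ∏ i, r (σ i) * q i := by
        rw [Finset.prod_mul_distrib, Equiv.prod_comp σ r]
      rw [h1]
      by_cases h0 : ∏ i, ‖X (σ i) i‖ = 0
      · rw [h0, ← h1]; exact hpos
      · refine Finset.prod_lt_prod (fun j hj => ?_) (fun j _ => hX _ _)
          ⟨i, Finset.mem_univ _, hlt _ _ hi⟩
        exact (norm_nonneg _).lt_of_ne fun h => h0 (Finset.prod_eq_zero hj h.symm)
  rw [← hone] at hrest
  rw [IsUltrametricDist.norm_add_eq_max_of_norm_ne_norm hrest.ne', max_eq_left hrest.le, hone]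

theorem norm_det_eq_of_lower {n : ℕ} {X : Matrix (Fin n) (Fin n) K} {r q : Fin n → ℝ}
    (hr : ∀ i, 0 < r i) (hq : ∀ i, 0 < q i) (hX : ∀ i j, ‖X i j‖ ≤ r i * q j)
    (hd : ∀ i, ‖X i i‖ = r i * q i) (hlt : ∀ i j, j < i → ‖X i j‖ < r i * q j) :
    ‖X.det‖ = (∏ i, r i) * ∏ i, q i := by
  rw [← Matrix.det_transpose, mul_comm (∏ i, r i)]
  exact norm_det_eq_of_upper (X := X.transpose) hq hr
    (fun i j => by rw [mul_comm]; exact hX j i) (fun i => by rw [mul_comm]; exact hd i)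
    (fun i j h => by rw [mul_comm]; exact hlt j i h)

/-- Cramer's rule with ultrametric estimates. If the columns `e j` of `R` form a square matrix whose
determinant is as large as the bound on the entries permits, then every further column `c₀` yields a
vector of the kernel of `R` that is supported on `c₀` and the columns `e j`, with coordinate `1` at
`c₀`. -/
theorem exists_kernel_vector {n : ℕ} {κ : Type*} [Fintype κ] [DecidableEq κ]
    {R : Matrix (Fin n) κ K} {r : Fin n → ℝ} {q : κ → ℝ}
    (hr : ∀ i, 0 < r i) (hq : ∀ c, 0 < q c) (hR : ∀ i c, ‖R i c‖ ≤ r i * q c)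
    {e : Fin n → κ} (he : Function.Injective e)
    (hdet : ‖(R.submatrix id e).det‖ = (∏ i, r i) * ∏ i, q (e i))
    {c₀ : κ} (hc₀ : ∀ j, e j ≠ c₀) :
    ∃ v : κ → K, R.mulVec v = 0 ∧ v c₀ = 1 ∧ (∀ c, c ≠ c₀ → (∀ j, e j ≠ c) → v c = 0) ∧
      ∀ c, ‖v c‖ ≤ q c₀ / q c := by
  set T := R.submatrix id e with hT
  have hpos : 0 < (∏ i, r i) * ∏ i, q (e i) :=
    mul_pos (Finset.prod_pos fun i _ => hr i) (Finset.prod_pos fun i _ => hq _)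
  have hT0 : T.det ≠ 0 := by rw [← norm_pos_iff, hdet]; exact hpos
  set b : Fin n → K := fun i => R i c₀ with hb
  set u : Fin n → K := fun j => -(T.det⁻¹ * T.cramer b j) with hu
  have hTu : T.mulVec u = -b := by
    have : u = (-T.det⁻¹) • T.cramer b := by ext j; simp [hu]
    rw [this, Matrix.mulVec_smul, Matrix.mulVec_cramer, smul_smul, neg_mul, inv_mul_cancel₀ hT0,
      neg_one_smul]
  have hub : ∀ j, ‖u j‖ ≤ q c₀ / q (e j) := by
    intro j
    have h1 : ‖T.cramer b j‖ ≤ (∏ i, r i) * ∏ i, Function.update (fun i => q (e i)) j (q c₀) i := by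
      rw [Matrix.cramer_apply]
      refine norm_det_le (fun i => (hr i).le) (fun i => ?_) fun i k => ?_
      · rcases eq_or_ne i j with rfl | h
        · simpa using (hq c₀).le
        · simpa [h] using (hq (e i)).le
      · rcases eq_or_ne k j with rfl | h
        · simpa [hb] using hR i c₀
        · simpa [h, hT] using hR i (e k)
    have h2 : (∏ i, Function.update (fun i => q (e i)) j (q c₀) i) * q (e j) =
        (∏ i, q (e i)) * q c₀ := by
      rw [Finset.prod_update_of_mem (Finset.mem_univ j), Finset.sdiff_singleton_eq_erase,
        ← Finset.mul_prod_erase _ (fun i => q (e i)) (Finset.mem_univ j)]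
      ring
    rw [hu, norm_neg, norm_mul, norm_inv, hdet, inv_mul_le_iff₀ hpos, mul_div_assoc',
      le_div_iff₀ (hq _)]
    calc _ ≤ ((∏ i, r i) * ∏ i, Function.update (fun i => q (e i)) j (q c₀) i) * q (e j) :=
          mul_le_mul_of_nonneg_right h1 (hq _).le
      _ = _ := by rw [mul_assoc, h2, mul_assoc]
  have hve : ∀ j, (Pi.single c₀ 1 + ∑ j, Pi.single (e j) (u j) : κ → K) (e j) = u j := by
    intro j
    rw [Pi.add_apply, Pi.single_eq_of_ne (hc₀ j), zero_add, Finset.sum_apply,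
      Finset.sum_eq_single j]
    · simp
    · intro k _ hk
      exact Pi.single_eq_of_ne (fun h => hk (he h).symm) _
    · simp
  have hv0 : (Pi.single c₀ 1 + ∑ j, Pi.single (e j) (u j) : κ → K) c₀ = 1 := by
    rw [Pi.add_apply, Pi.single_eq_same, Finset.sum_apply, Finset.sum_eq_zero, add_zero]
    exact fun j _ => Pi.single_eq_of_ne (hc₀ j).symm _
  have hvc : ∀ c, c ≠ c₀ → (∀ j, e j ≠ c) →
      (Pi.single c₀ 1 + ∑ j, Pi.single (e j) (u j) : κ → K) c = 0 := by
    intro c h h'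
    rw [Pi.add_apply, Pi.single_eq_of_ne h, zero_add, Finset.sum_apply]
    exact Finset.sum_eq_zero fun j _ => Pi.single_eq_of_ne (h' j).symm _
  refine ⟨_, ?_, hv0, hvc, ?_⟩
  · rw [Matrix.mulVec_add, Matrix.mulVec_single_one, Matrix.mulVec_sum]
    have : ∑ j, R.mulVec (Pi.single (e j) (u j)) = T.mulVec u := by
      ext i
      simp [Matrix.mulVec, dotProduct, hT, Finset.sum_apply, mul_comm]
    rw [this, hTu]
    ext i
    simp [hb]
  · intro c
    by_cases h : c = c₀
    · subst h; rw [hv0, div_self (hq _).ne']; simp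
    · by_cases h' : ∀ j, e j ≠ c
      · rw [hvc c h h', norm_zero]; exact (div_pos (hq _) (hq _)).le
      · push Not at h'
        obtain ⟨j, rfl⟩ := h'
        rw [hve]; exact hub j

end UltrametricDet

/-! ### Complementary minors and block triangular matrices -/

/-- Complementary minors of a matrix `R` and of a matrix `N` whose rows lie in the kernel of `R` are
proportional, up to sign. Each of `f`, `g` splits the columns into a part for `R` and a part
for `N`. -/
theorem det_mul_det_complementary {K α β ι : Type*} [CommRing K] [Fintype α] [Fintype β]
    [Fintype ι] [DecidableEq α] [DecidableEq β] [DecidableEq ι]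
    {R : Matrix α ι K} {N : Matrix β ι K} (h : R * N.transpose = 0) (f g : α ⊕ β ≃ ι) :
    ∃ ε : ℤˣ, (R.submatrix id (f ∘ Sum.inl)).det * (N.submatrix id (g ∘ Sum.inr)).det =
      ((ε : ℤ) : K) *
        ((R.submatrix id (g ∘ Sum.inl)).det * (N.submatrix id (f ∘ Sum.inr)).det) := by
  set Q : Matrix (α ⊕ β) ι K := Matrix.of (Sum.elim (fun i => R i)
    fun j => Pi.single (f (Sum.inr j)) 1) with hQ
  set X : Matrix ι (α ⊕ β) K := (Matrix.of (Sum.elim (fun i => Pi.single (g (Sum.inl i)) 1)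
    fun j => N j)).transpose with hX
  have hQf : Q.submatrix id f = Matrix.fromBlocks (R.submatrix id (f ∘ Sum.inl))
      (R.submatrix id (f ∘ Sum.inr)) 0 1 := by
    ext (i | i) (j | j) <;> simp [hQ, Matrix.one_apply, Pi.single_apply, eq_comm]
  have hXg : X.submatrix g id = Matrix.fromBlocks 1 (N.submatrix id (g ∘ Sum.inl)).transpose
      0 (N.submatrix id (g ∘ Sum.inr)).transpose := by
    ext (i | i) (j | j) <;> simp [hX, Matrix.one_apply, Pi.single_apply, eq_comm]
  have hQX : Q * X = Matrix.fromBlocks (R.submatrix id (g ∘ Sum.inl)) 0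
      (Matrix.of fun i j => Q (Sum.inr i) (g (Sum.inl j)))
      (N.submatrix id (f ∘ Sum.inr)).transpose := by
    ext (i | i) (j | j)
    · simp [hQ, hX, Matrix.mul_apply, Pi.single_apply]
    · simpa [hQ, hX, Matrix.mul_apply] using congrFun (congrFun h i) j
    · simp [hX, Matrix.mul_apply, Pi.single_apply]
    · simp [hQ, hX, Matrix.mul_apply, Pi.single_apply]
  have hXf : X.submatrix f id = (X.submatrix g id).submatrix (f.trans g.symm) id := by
    ext i j; simp
  refine ⟨Equiv.Perm.sign (f.trans g.symm), ?_⟩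
  have h1 : (Q.submatrix id f).det * (X.submatrix f id).det = (Q * X).det := by
    rw [← Matrix.det_mul, Matrix.submatrix_mul_equiv, Matrix.submatrix_id_id]
  rw [hXf, Matrix.det_permute, hXg, hQf, hQX, Matrix.det_fromBlocks_zero₂₁,
    Matrix.det_fromBlocks_zero₂₁, Matrix.det_fromBlocks_zero₁₂, Matrix.det_transpose,
    Matrix.det_transpose, Matrix.det_one, Matrix.det_one, mul_one, one_mul] at h1
  have hs : (((Equiv.Perm.sign (f.trans g.symm) : ℤˣ) : ℤ) : K) *
      (((Equiv.Perm.sign (f.trans g.symm) : ℤˣ) : ℤ) : K) = 1 := by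
    rw [← Int.cast_mul, ← Units.val_mul, Int.units_mul_self]; simp
  rw [← h1]
  linear_combination (-(R.submatrix id (f ∘ Sum.inl)).det * (N.submatrix id (g ∘ Sum.inr)).det) * hs

open Matrix in
theorem det_eq_one_of_blockTriangular_injective {R ι α : Type*} [CommRing R] [Fintype ι]
    [DecidableEq ι] [LinearOrder α] {M : Matrix ι ι R} {b : ι → α} (hb : Function.Injective b)
    (hM : BlockTriangular M b) (h1 : ∀ i, M i i = 1) : M.det = 1 := by
  rw [hM.det]
  refine Finset.prod_eq_one fun a ha => ?_
  have : M.toSquareBlock b a = 1 := by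
    ext ⟨i, hi⟩ ⟨j, hj⟩
    obtain rfl : i = j := hb (hi.trans hj.symm)
    simp [toSquareBlock_def, h1]
  rw [this, det_one]

open Matrix in
/-- A matrix that carries one block triangular matrix with invertible diagonal blocks to another one
is itself block triangular. -/
theorem blockTriangular_of_mul_eq {R ι α : Type*} [CommRing R] [IsDomain R] [Fintype ι]
    [DecidableEq ι] [LinearOrder α] {G L L' : Matrix ι ι R} {b : ι → α}
    (hL : BlockTriangular L b) (hL' : BlockTriangular L' b)
    (hdet : ∀ k, (L.toSquareBlock b k).det ≠ 0) (hG : G * L = L') : BlockTriangular G b := by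
  have hd : L.det ≠ 0 := by
    rw [hL.det]; exact Finset.prod_ne_zero_iff.mpr fun k _ => hdet k
  let φ := algebraMap R (FractionRing R)
  have hφ : Function.Injective φ := IsFractionRing.injective R _
  have hd' : IsUnit (L.map φ).det := by
    rw [← RingHom.mapMatrix_apply, ← RingHom.map_det, isUnit_iff_ne_zero]
    exact fun h => hd (hφ (h.trans (map_zero φ).symm))
  let := invertibleOfIsUnitDet _ hd'
  have h1 : G.map φ = L'.map φ * (L.map φ)⁻¹ := by
    rw [← hG, Matrix.map_mul, mul_nonsing_inv_cancel_right _ _ hd']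
  have h2 : BlockTriangular (G.map φ) b := by
    rw [h1]
    exact (hL'.map φ).mul (blockTriangular_inv_of_blockTriangular (hL.map φ))
  intro i j hij
  have := h2 hij
  exact hφ (this.trans (map_zero φ).symm)

open Matrix in
theorem toSquareBlock_mul_of_blockTriangular {R ι α : Type*} [CommRing R] [Fintype ι]
    [LinearOrder α] {G L : Matrix ι ι R} {b : ι → α}
    (hG : BlockTriangular G b) (hL : BlockTriangular L b) (k : α) :
    (G * L).toSquareBlock b k = G.toSquareBlock b k * L.toSquareBlock b k := by
  ext ⟨i, hi⟩ ⟨j, hj⟩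
  symm
  refine Fintype.sum_of_injective (Subtype.val : {x // b x = k} → ι) Subtype.val_injective
    (fun x => G i x * L x j) (fun x => G i x * L x j) (fun x hx => ?_) fun _ => rfl
  have hxk : b x ≠ k := fun h => hx ⟨⟨x, h⟩, rfl⟩
  rcases lt_or_gt_of_ne hxk with h | h
  · rw [hG (show b x < b i by rwa [hi]), zero_mul]
  · rw [hL (show b j < b x by rwa [hj]), mul_zero]

/-! ### The Newton polygon -/

theorem mem_newtonVertices {p : ℕ} {A : ℤ[X]} {i : ℕ} :
    i ∈ newtonVertices p A ↔ A.coeff i ≠ 0 ∧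
      ((i : ℝ), (padicValInt p (A.coeff i) : ℝ)) ∈ (newtonRegion p A).extremePoints ℝ := by
  simp [newtonVertices]

theorem mem_newtonRegion {p : ℕ} {A : ℤ[X]} {i : ℕ} (hi : A.coeff i ≠ 0) {y : ℝ}
    (hy : (padicValInt p (A.coeff i) : ℝ) ≤ y) : ((i : ℝ), y) ∈ newtonRegion p A :=
  subset_convexHull _ _ ⟨i, hi, rfl, hy⟩

/-- A point with a strict supporting line is a vertex. -/
theorem mem_newtonVertices_of_strict_support {p : ℕ} {A : ℤ[X]} {i : ℕ} (hi : A.coeff i ≠ 0)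
    (l : ℝ) (h : ∀ n, A.coeff n ≠ 0 → n ≠ i →
      (padicValInt p (A.coeff i) : ℝ) + l * ((n : ℝ) - i) < padicValInt p (A.coeff n)) :
    i ∈ newtonVertices p A := by
  rw [mem_newtonVertices]
  refine ⟨hi, mem_newtonRegion hi le_rfl, ?_⟩
  set P : ℝ × ℝ := ((i : ℝ), (padicValInt p (A.coeff i) : ℝ)) with hP
  -- The region lies in the union of the vertex and the open half plane above the line.
  have hsub : newtonRegion p A ⊆ {q : ℝ × ℝ | q = P ∨ P.2 - l * P.1 < q.2 - l * q.1} := by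
    refine convexHull_min ?_ ?_
    · rintro ⟨x, y⟩ ⟨n, hn, hx, hy⟩
      simp only at hx hy
      subst hx
      rcases eq_or_ne n i with rfl | hni
      · rcases hy.eq_or_lt with h' | h'
        · exact Or.inl (by rw [hP, h'])
        · exact Or.inr (by simpa [hP] using h')
      · refine Or.inr ?_
        have := h n hn hni
        simp only [hP]
        linarith
    · rw [convex_iff_forall_pos]
      rintro x hx y hy a b ha hb hab
      obtain rfl : a = 1 - b := by linarith
      rcases hx with rfl | hx
      · rcases hy with rfl | hy
        · exact Or.inl (by rw [← add_smul, hab, one_smul])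
        · refine Or.inr ?_
          simp only [Prod.snd_add, Prod.smul_snd, smul_eq_mul, Prod.fst_add, Prod.smul_fst]
          nlinarith [mul_lt_mul_of_pos_left hy hb]
      · have hy' : P.2 - l * P.1 ≤ y.2 - l * y.1 := by
          rcases hy with rfl | hy
          · exact le_rfl
          · exact hy.le
        refine Or.inr ?_
        simp only [Prod.snd_add, Prod.smul_snd, smul_eq_mul, Prod.fst_add, Prod.smul_fst]
        nlinarith [mul_lt_mul_of_pos_left hx ha, mul_le_mul_of_nonneg_left hy' hb.le]
  rintro x₁ hx₁ x₂ hx₂ ⟨a, b, ha, hb, hab, hx⟩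
  rcases hsub hx₁ with h₁ | h₁
  · exact h₁
  · exfalso
    have h₂ : P.2 - l * P.1 ≤ x₂.2 - l * x₂.1 := by
      rcases hsub hx₂ with rfl | h₂
      · exact le_rfl
      · exact h₂.le
    have e1 : P.1 = a * x₁.1 + b * x₂.1 := by rw [← hx]; simp
    have e2 : P.2 = a * x₁.2 + b * x₂.2 := by rw [← hx]; simp
    obtain rfl : a = 1 - b := by linarith
    have e3 : P.2 - l * P.1 = (1 - b) * (x₁.2 - l * x₁.1) + b * (x₂.2 - l * x₂.1) := by
      linear_combination e2 - l * e1
    nlinarith [mul_lt_mul_of_pos_left h₁ ha, mul_le_mul_of_nonneg_left h₂ hb.le]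

/-- A vertex lies strictly below every chord that passes over it. -/
theorem lt_chord_of_mem_newtonVertices {p : ℕ} {A : ℤ[X]} {i n n' : ℕ}
    (hi : i ∈ newtonVertices p A) (hn : A.coeff n ≠ 0) (hn' : A.coeff n' ≠ 0)
    (hni : n < i) (hin : i < n') :
    (padicValInt p (A.coeff i) : ℝ) * ((n' : ℝ) - n) <
      padicValInt p (A.coeff n) * ((n' : ℝ) - i) + padicValInt p (A.coeff n') * ((i : ℝ) - n) := by
  by_contra! hle
  obtain ⟨-, -, hext⟩ := mem_newtonVertices.mp hi
  have h1 : (n : ℝ) < i := by exact_mod_cast hni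
  have h2 : (i : ℝ) < n' := by exact_mod_cast hin
  have h3 : (0 : ℝ) < n' - n := by linarith
  set y := (padicValInt p (A.coeff i) : ℝ)
  set u := (padicValInt p (A.coeff n) : ℝ)
  set u' := (padicValInt p (A.coeff n') : ℝ)
  -- Both ends of the chord are raised by `δ`, so that it passes through the vertex.
  set δ := y - (u * ((n' : ℝ) - i) + u' * ((i : ℝ) - n)) / (n' - n) with hδ
  have hδ0 : 0 ≤ δ := by
    rw [hδ, sub_nonneg, div_le_iff₀ h3]; exact hle
  have := hext (mem_newtonRegion hn (show u ≤ u + δ by linarith))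
    (mem_newtonRegion hn' (show u' ≤ u' + δ by linarith))
    ⟨((n' : ℝ) - i) / (n' - n), ((i : ℝ) - n) / (n' - n), div_pos (by linarith) h3,
      div_pos (by linarith) h3, by field_simp; ring, by
        ext
        · simp only [Prod.fst_add, Prod.smul_fst, smul_eq_mul]; field_simp; ring
        · simp only [Prod.snd_add, Prod.smul_snd, smul_eq_mul, hδ]; field_simp; ring⟩
  exact h1.ne (congrArg Prod.fst this)

theorem zero_mem_newtonVertices {p : ℕ} {A : ℤ[X]} (h0 : A.coeff 0 ≠ 0) :
    0 ∈ newtonVertices p A := by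
  have : ∀ᶠ l : ℝ in Filter.atBot, ∀ n ∈ A.support.erase 0,
      l < ((padicValInt p (A.coeff n) : ℝ) - padicValInt p (A.coeff 0)) / n :=
    (Filter.eventually_all_finset _).mpr fun n _ => Filter.eventually_lt_atBot _
  obtain ⟨l, hl⟩ := this.exists
  refine mem_newtonVertices_of_strict_support h0 l fun n hn hn0 => ?_
  have hpos : (0 : ℝ) < n := by exact_mod_cast Nat.pos_of_ne_zero hn0
  have := hl n (by simp [hn0, hn])
  rw [lt_div_iff₀ hpos] at this
  push_cast
  linarith

/-- To the right of a vertex `w` other than the last one there is a next vertex `w'`, and the line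
through the two supports the polygon, with contact only between `w` and `w'`. -/
theorem exists_next_newtonVertex {p : ℕ} {A : ℤ[X]} {w : ℕ} (hw : w ∈ newtonVertices p A)
    (hwd : w < A.natDegree) :
    ∃ w' ∈ newtonVertices p A, w < w' ∧ (∀ x ∈ newtonVertices p A, w < x → w' ≤ x) ∧
      ∃ l : ℝ, (padicValInt p (A.coeff w') : ℝ) = padicValInt p (A.coeff w) + l * ((w' : ℝ) - w) ∧
        (∀ n, A.coeff n ≠ 0 →
          (padicValInt p (A.coeff w) : ℝ) + l * ((n : ℝ) - w) ≤ padicValInt p (A.coeff n)) ∧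
        (∀ n, A.coeff n ≠ 0 → n < w ∨ w' < n →
          (padicValInt p (A.coeff w) : ℝ) + l * ((n : ℝ) - w) < padicValInt p (A.coeff n)) := by
  classical
  have hAw : A.coeff w ≠ 0 := (mem_newtonVertices.mp hw).1
  set v : ℕ → ℝ := fun n => (padicValInt p (A.coeff n) : ℝ) with hv
  set f : ℕ → ℝ := fun n => (v n - v w) / ((n : ℝ) - w) with hf
  have hA0 : A ≠ 0 := by rintro rfl; simp at hwd
  set S := A.support.filter (w < ·) with hS
  have hSne : S.Nonempty := ⟨A.natDegree, by simp [hS, hwd, hA0]⟩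
  obtain ⟨x₀, hx₀, hmin⟩ := S.exists_min_image f hSne
  set l := f x₀ with hl
  obtain ⟨w', hw'S, hmax⟩ := (S.filter fun n => f n = l).exists_max_image id
    ⟨x₀, by simp [hx₀, hl]⟩
  simp only [Finset.mem_filter, hS, Polynomial.mem_support_iff, id, and_imp] at hw'S hmax hmin
  obtain ⟨⟨hAw', hww'⟩, hfw'⟩ := hw'S
  have key : ∀ n, w < n → f n * ((n : ℝ) - w) = v n - v w := by
    intro n hn
    have : (w : ℝ) < n := by exact_mod_cast hn
    rw [hf]; exact div_mul_cancel₀ _ (by linarith)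
  have hww'r : (w : ℝ) < w' := by exact_mod_cast hww'
  have hline : v w' = v w + l * ((w' : ℝ) - w) := by
    have := key w' hww'
    rw [hfw'] at this; linarith
  have hleft : ∀ n, A.coeff n ≠ 0 → n < w → v w + l * ((n : ℝ) - w) < v n := by
    intro n hn hnw
    have h1 := lt_chord_of_mem_newtonVertices hw hn hAw' hnw hww'
    have h2 : (n : ℝ) < w := by exact_mod_cast hnw
    change v w * ((w' : ℝ) - n) < v n * ((w' : ℝ) - w) + v w' * ((w : ℝ) - n) at h1
    rw [hline] at h1
    have h3 : (v w + l * ((n : ℝ) - w)) * ((w' : ℝ) - w) < v n * ((w' : ℝ) - w) := by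
      nlinarith
    exact lt_of_mul_lt_mul_right h3 (by linarith)
  have hright : ∀ n, A.coeff n ≠ 0 → w < n → v w + l * ((n : ℝ) - w) ≤ v n := by
    intro n hn hwn
    have h2 : (w : ℝ) < n := by exact_mod_cast hwn
    have := mul_le_mul_of_nonneg_right (hmin n hn hwn) (show (0 : ℝ) ≤ n - w by linarith)
    rw [key n hwn] at this; linarith
  have hfar : ∀ n, A.coeff n ≠ 0 → w' < n → v w + l * ((n : ℝ) - w) < v n := by
    intro n hn hwn
    have hwn' := hww'.trans hwn
    have h2 : (w : ℝ) < n := by exact_mod_cast hwn'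
    have hne : f n ≠ l := fun h => absurd (hmax n hn hwn' h) (not_le.mpr hwn)
    have := mul_lt_mul_of_pos_right ((hmin n hn hwn').lt_of_ne hne.symm)
      (show (0 : ℝ) < n - w by linarith)
    rw [key n hwn'] at this; linarith
  have hall : ∀ n, A.coeff n ≠ 0 → v w + l * ((n : ℝ) - w) ≤ v n := by
    intro n hn
    rcases lt_trichotomy n w with h | rfl | h
    · exact (hleft n hn h).le
    · simp
    · exact hright n hn h
  refine ⟨w', ?_, hww', ?_, l, hline, hall, fun n hn h => h.elim (hleft n hn) (hfar n hn)⟩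
  · -- A slightly steeper line through `w'` supports the polygon strictly.
    have : ∀ᶠ l' : ℝ in nhdsWithin l (Set.Ioi l), ∀ n ∈ A.support.filter (w' < ·),
        l' < (v n - v w') / ((n : ℝ) - w') := by
      refine (Filter.eventually_all_finset _).mpr fun n hn => ?_
      simp only [Finset.mem_filter, Polynomial.mem_support_iff] at hn
      refine eventually_nhdsWithin_of_eventually_nhds (eventually_lt_nhds ?_)
      have h2 : (w' : ℝ) < n := by exact_mod_cast hn.2
      rw [lt_div_iff₀ (by linarith)]
      linarith [hfar n hn.1 hn.2]
    obtain ⟨l', hl', hll'⟩ := (this.and self_mem_nhdsWithin).exists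
    have hll' : l < l' := hll'
    refine mem_newtonVertices_of_strict_support hAw' l' fun n hn hne => ?_
    change v w' + l' * ((n : ℝ) - w') < v n
    rcases lt_or_gt_of_ne hne with h | h
    · have h2 : (n : ℝ) < w' := by exact_mod_cast h
      have := hall n hn
      nlinarith
    · have h2 : (w' : ℝ) < n := by exact_mod_cast h
      have := hl' n (by simp [hn, h])
      rw [lt_div_iff₀ (by linarith)] at this
      linarith
  · intro x hx hwx
    by_contra! hxw
    have hAx : A.coeff x ≠ 0 := (mem_newtonVertices.mp hx).1
    have h1 := lt_chord_of_mem_newtonVertices hx hAw hAw' hwx hxw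
    change v x * ((w' : ℝ) - w) < v w * ((w' : ℝ) - x) + v w' * ((x : ℝ) - w) at h1
    rw [hline] at h1
    have h2 := mul_le_mul_of_nonneg_right (hall x hAx) (show (0 : ℝ) ≤ w' - w by linarith)
    nlinarith

theorem finite_newtonVertices (p : ℕ) (A : ℤ[X]) :
    (Set.ofPred fun i => i ∈ newtonVertices p A).Finite :=
  (newtonVertices p A).finite_toSet

theorem card_newtonVertices {p : ℕ} {A : ℤ[X]} (h0 : A.coeff 0 ≠ 0) :
    (finite_newtonVertices p A).toFinset.card = newtonEdges p A + 1 := by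
  have h1 : (finite_newtonVertices p A).toFinset = newtonVertices p A := by ext; simp
  have h2 : 0 < (newtonVertices p A).card :=
    Finset.card_pos.mpr ⟨0, zero_mem_newtonVertices h0⟩
  rw [h1, newtonEdges]; omega

theorem newtonAbscissa_mem {p : ℕ} {A : ℤ[X]} (h0 : A.coeff 0 ≠ 0) {k : ℕ}
    (hk : k ≤ newtonEdges p A) : newtonAbscissa p A k ∈ newtonVertices p A :=
  Nat.nth_mem_of_lt_card (finite_newtonVertices p A) (by rw [card_newtonVertices h0]; omega)

theorem coeff_newtonAbscissa_ne_zero {p : ℕ} {A : ℤ[X]} (h0 : A.coeff 0 ≠ 0) {k : ℕ}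
    (hk : k ≤ newtonEdges p A) : A.coeff (newtonAbscissa p A k) ≠ 0 :=
  (mem_newtonVertices.mp (newtonAbscissa_mem h0 hk)).1

theorem newtonAbscissa_zero {p : ℕ} {A : ℤ[X]} (h0 : A.coeff 0 ≠ 0) :
    newtonAbscissa p A 0 = 0 :=
  Nat.nth_zero_of_zero (zero_mem_newtonVertices h0)

theorem newtonAbscissa_lt {p : ℕ} {A : ℤ[X]} (h0 : A.coeff 0 ≠ 0) {j k : ℕ} (hjk : j < k)
    (hk : k ≤ newtonEdges p A) : newtonAbscissa p A j < newtonAbscissa p A k :=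
  Nat.nth_lt_nth_of_lt_card (finite_newtonVertices p A) hjk
    (by rw [card_newtonVertices h0]; omega)

theorem newtonAbscissa_mono {p : ℕ} {A : ℤ[X]} (h0 : A.coeff 0 ≠ 0) {j k : ℕ} (hjk : j ≤ k)
    (hk : k ≤ newtonEdges p A) : newtonAbscissa p A j ≤ newtonAbscissa p A k :=
  Nat.nth_le_nth_of_lt_card (finite_newtonVertices p A) hjk
    (by rw [card_newtonVertices h0]; omega)

theorem exists_newtonAbscissa_eq {p : ℕ} {A : ℤ[X]} (h0 : A.coeff 0 ≠ 0) {w : ℕ}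
    (hw : w ∈ newtonVertices p A) : ∃ k ≤ newtonEdges p A, newtonAbscissa p A k = w := by
  obtain ⟨k, hk, h⟩ := Nat.exists_lt_card_finite_nth_eq (finite_newtonVertices p A) hw
  rw [card_newtonVertices h0] at hk
  exact ⟨k, by omega, h⟩

theorem newtonAbscissa_newtonEdges {p : ℕ} {A : ℤ[X]} (h0 : A.coeff 0 ≠ 0) :
    newtonAbscissa p A (newtonEdges p A) = A.natDegree := by
  by_contra hne
  obtain ⟨w', hw', hlt, -⟩ := exists_next_newtonVertex (newtonAbscissa_mem h0 le_rfl)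
    ((newtonAbscissa_le p A _).lt_of_ne hne)
  obtain ⟨k, hk, rfl⟩ := exists_newtonAbscissa_eq h0 hw'
  exact absurd (newtonAbscissa_mono h0 hk le_rfl) (not_le.mpr hlt)

/-- The line through the `k`-th edge supports the Newton polygon, with contact only on the edge. -/
theorem newtonSlope_support {p : ℕ} {A : ℤ[X]} (h0 : A.coeff 0 ≠ 0) {k : ℕ}
    (hk : k < newtonEdges p A) :
    (padicValInt p (A.coeff (newtonAbscissa p A (k + 1))) : ℝ) =
        padicValInt p (A.coeff (newtonAbscissa p A k)) + newtonSlope p A k *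
          ((newtonAbscissa p A (k + 1) : ℝ) - newtonAbscissa p A k) ∧
      (∀ n, A.coeff n ≠ 0 → (padicValInt p (A.coeff (newtonAbscissa p A k)) : ℝ) +
        newtonSlope p A k * ((n : ℝ) - newtonAbscissa p A k) ≤ padicValInt p (A.coeff n)) ∧
      (∀ n, A.coeff n ≠ 0 → n < newtonAbscissa p A k ∨ newtonAbscissa p A (k + 1) < n →
        (padicValInt p (A.coeff (newtonAbscissa p A k)) : ℝ) +
          newtonSlope p A k * ((n : ℝ) - newtonAbscissa p A k) < padicValInt p (A.coeff n)) := by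
  have hlt := newtonAbscissa_lt h0 (Nat.lt_succ_self k) hk
  obtain ⟨w', hw', hww', hnext, l, hl, h1, h2⟩ := exists_next_newtonVertex
    (newtonAbscissa_mem h0 hk.le) (hlt.trans_le (newtonAbscissa_le p A _))
  have hw'eq : w' = newtonAbscissa p A (k + 1) := by
    refine le_antisymm (hnext _ (newtonAbscissa_mem h0 hk) hlt) ?_
    obtain ⟨j, hj, rfl⟩ := exists_newtonAbscissa_eq h0 hw'
    refine newtonAbscissa_mono h0 ?_ hj
    by_contra! hjk
    exact absurd (newtonAbscissa_mono h0 (Nat.le_of_lt_succ hjk) hk.le) (not_le.mpr hww')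
  subst hw'eq
  have hpos : (newtonAbscissa p A k : ℝ) < newtonAbscissa p A (k + 1) := by exact_mod_cast hlt
  have hlen : (newtonLength p A k : ℝ) =
      (newtonAbscissa p A (k + 1) : ℝ) - newtonAbscissa p A k := by
    rw [newtonLength, Nat.cast_sub hlt.le]
  have hslope : (newtonSlope p A k : ℝ) = l := by
    rw [newtonSlope]
    push_cast
    rw [hlen, hl, div_eq_iff (by linarith)]
    ring
  rw [hslope]
  exact ⟨hl, h1, h2⟩

theorem newtonSlope_support_right {p : ℕ} {A : ℤ[X]} (h0 : A.coeff 0 ≠ 0) {k : ℕ}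
    (hk : k < newtonEdges p A) :
    (∀ n, A.coeff n ≠ 0 → (padicValInt p (A.coeff (newtonAbscissa p A (k + 1))) : ℝ) +
        newtonSlope p A k * ((n : ℝ) - newtonAbscissa p A (k + 1)) ≤ padicValInt p (A.coeff n)) ∧
      (∀ n, A.coeff n ≠ 0 → newtonAbscissa p A (k + 1) < n →
        (padicValInt p (A.coeff (newtonAbscissa p A (k + 1))) : ℝ) +
          newtonSlope p A k * ((n : ℝ) - newtonAbscissa p A (k + 1)) <
            padicValInt p (A.coeff n)) := by
  obtain ⟨e, h1, h2⟩ := newtonSlope_support h0 hk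
  exact ⟨fun n hn => by linarith [h1 n hn], fun n hn h => by linarith [h2 n hn (Or.inr h)]⟩

theorem newtonSlope_lt_succ {p : ℕ} {A : ℤ[X]} (h0 : A.coeff 0 ≠ 0) {k : ℕ}
    (hk : k + 1 < newtonEdges p A) : newtonSlope p A k < newtonSlope p A (k + 1) := by
  have hlt := newtonAbscissa_lt h0 (Nat.lt_succ_self (k + 1)) hk
  obtain ⟨e, -, h⟩ := newtonSlope_support h0 ((Nat.lt_succ_self k).trans hk)
  obtain ⟨e', -, -⟩ := newtonSlope_support h0 hk
  have h' := h _ (coeff_newtonAbscissa_ne_zero h0 hk) (Or.inr hlt)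
  have hpos : (newtonAbscissa p A (k + 1) : ℝ) < newtonAbscissa p A (k + 1 + 1) := by
    exact_mod_cast hlt
  have : (newtonSlope p A k : ℝ) * ((newtonAbscissa p A (k + 1 + 1) : ℝ) -
      newtonAbscissa p A (k + 1)) < newtonSlope p A (k + 1) *
      ((newtonAbscissa p A (k + 1 + 1) : ℝ) - newtonAbscissa p A (k + 1)) := by
    rw [e', e] at h'; linarith
  exact_mod_cast lt_of_mul_lt_mul_right this (by linarith)

theorem newtonSlope_mono {p : ℕ} {A : ℤ[X]} (h0 : A.coeff 0 ≠ 0) {j k : ℕ} (hjk : j ≤ k)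
    (hk : k < newtonEdges p A) : newtonSlope p A j ≤ newtonSlope p A k := by
  induction k, hjk using Nat.le_induction with
  | base => exact le_rfl
  | succ k _ ih => exact (ih (by omega)).trans (newtonSlope_lt_succ h0 hk).le

/-- Every row or column index lies in one of the blocks. -/
theorem exists_blockIndex_eq {p : ℕ} {A : ℤ[X]} (h0 : A.coeff 0 ≠ 0) (j : Fin A.natDegree) :
    ∃ k < newtonEdges p A, ∃ a, blockIndex p A k a = j := by
  classical
  have hex : ∃ k, (j : ℕ) < newtonAbscissa p A k :=
    ⟨newtonEdges p A, by rw [newtonAbscissa_newtonEdges h0]; exact j.isLt⟩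
  have hspec := Nat.find_spec hex
  have hle : Nat.find hex ≤ newtonEdges p A :=
    Nat.find_min' hex (by rw [newtonAbscissa_newtonEdges h0]; exact j.isLt)
  obtain ⟨k, hk⟩ : ∃ k, Nat.find hex = k + 1 := Nat.exists_eq_succ_of_ne_zero fun h => by
    rw [h, newtonAbscissa_zero h0] at hspec; omega
  rw [hk] at hspec hle
  have hmin := Nat.find_min hex (m := k) (by omega)
  refine ⟨k, by omega, ⟨j - newtonAbscissa p A k, by unfold newtonLength; omega⟩, ?_⟩
  ext
  simp only [blockIndex]
  omega

theorem blockIndex_bounds {p : ℕ} {A : ℤ[X]} {k : ℕ} (a : Fin (newtonLength p A k)) :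
    newtonAbscissa p A k ≤ blockIndex p A k a ∧
      (blockIndex p A k a : ℕ) < newtonAbscissa p A (k + 1) := by
  have := a.isLt
  unfold newtonLength at this
  simp only [blockIndex]
  omega

theorem blockIndex_injective {p : ℕ} {A : ℤ[X]} {k : ℕ} :
    Function.Injective (blockIndex p A k) := by
  intro a b h
  have := congrArg Fin.val h
  simp only [blockIndex] at this
  ext; omega

theorem eq_of_blockIndex_eq {p : ℕ} {A : ℤ[X]} (h0 : A.coeff 0 ≠ 0) {k l : ℕ}
    (hk : k < newtonEdges p A) (hl : l < newtonEdges p A) {a : Fin (newtonLength p A k)}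
    {b : Fin (newtonLength p A l)} (h : blockIndex p A k a = blockIndex p A l b) : k = l := by
  have ha := blockIndex_bounds a
  have hb := blockIndex_bounds b
  rw [h] at ha
  rcases lt_trichotomy k l with h | h | h
  · have := newtonAbscissa_mono h0 (show k + 1 ≤ l from h) hl.le; omega
  · exact h
  · have := newtonAbscissa_mono h0 (show l + 1 ≤ k from h) hk.le; omega

/-! ### Extension of scalars to the `p`-adic integers -/

/-- The coordinate vector of an element of the extension of scalars of the module of
recurrences. -/
noncomputable def recurrenceVector (p : ℕ) [Fact p.Prime] (A : ℤ[X]) (m : ℕ) :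
    ℤ_[p] ⊗[ℤ] recurrenceModule A m →ₗ[ℤ_[p]] (Fin m → ℤ_[p]) :=
  LinearMap.pi (recurrenceCoord p A m)

theorem recurrenceVector_eq (p : ℕ) [Fact p.Prime] (A : ℤ[X]) (m : ℕ)
    (x : ℤ_[p] ⊗[ℤ] recurrenceModule A m) :
    recurrenceVector p A m x = TensorProduct.piScalarRight ℤ ℤ_[p] ℤ_[p] (Fin m)
      (LinearMap.lTensor ℤ_[p] (recurrenceModule A m).subtype x) := by
  induction x with
  | zero => simp
  | add x y hx hy => simp only [map_add, hx, hy]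
  | tmul x v =>
    ext j
    simp [recurrenceVector, recurrenceCoord]

theorem piScalarRight_lTensor_mulVecLin {p : ℕ} [Fact p.Prime] {n m : ℕ}
    (R : Matrix (Fin n) (Fin m) ℤ) (x : ℤ_[p] ⊗[ℤ] (Fin m → ℤ)) :
    TensorProduct.piScalarRight ℤ ℤ_[p] ℤ_[p] (Fin n) (LinearMap.lTensor ℤ_[p] R.mulVecLin x) =
      (R.map (Int.castRingHom ℤ_[p])).mulVec
        (TensorProduct.piScalarRight ℤ ℤ_[p] ℤ_[p] (Fin m) x) := by
  induction x with
  | zero => simp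
  | add x y hx hy => simp only [map_add, hx, hy, Matrix.mulVec_add]
  | tmul x v =>
    ext j
    simp [Matrix.mulVec, dotProduct, Finset.sum_mul, mul_assoc]

theorem recurrenceVector_injective (p : ℕ) [Fact p.Prime] (A : ℤ[X]) (m : ℕ) :
    Function.Injective (recurrenceVector p A m) := by
  intro x y h
  rw [recurrenceVector_eq, recurrenceVector_eq] at h
  exact Module.Flat.lTensor_preserves_injective_linearMap _
    (recurrenceModule A m).injective_subtype ((LinearEquiv.injective _) h)

/-- As `ℤ_[p]` is flat over `ℤ`, the coordinate vectors are exactly the `p`-adic recurrences. -/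
theorem exists_recurrenceVector_eq_iff {p : ℕ} [Fact p.Prime] {A : ℤ[X]} {m : ℕ}
    {v : Fin m → ℤ_[p]} :
    (∃ x, recurrenceVector p A m x = v) ↔
      ((recurrenceMatrix A m).map (Int.castRingHom ℤ_[p])).mulVec v = 0 := by
  set e := TensorProduct.piScalarRight ℤ ℤ_[p] ℤ_[p] (Fin m) with he
  have hker : ((recurrenceMatrix A m).map (Int.castRingHom ℤ_[p])).mulVec v = 0 ↔
      e.symm v ∈ LinearMap.ker (TensorProduct.AlgebraTensorModule.lTensor ℤ_[p] ℤ_[p]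
        (recurrenceMatrix A m).mulVecLin) := by
    rw [LinearMap.mem_ker, TensorProduct.AlgebraTensorModule.coe_lTensor,
      ← (TensorProduct.piScalarRight ℤ ℤ_[p] ℤ_[p] _).map_eq_zero_iff,
      piScalarRight_lTensor_mulVecLin, ← he, e.apply_symm_apply]
  rw [hker, Module.Flat.ker_lTensor_eq]
  constructor
  · rintro ⟨x, rfl⟩
    exact ⟨x, by rw [recurrenceVector_eq, ← he, e.symm_apply_apply]; rfl⟩
  · rintro ⟨x, hx⟩
    refine ⟨x, (recurrenceVector_eq p A m x).trans ?_⟩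
    rw [← e.apply_symm_apply v, ← hx]
    rfl

/-! ### Recurrences supported on a window -/

theorem norm_coeff_eq_rpow {p : ℕ} [Fact p.Prime] {a : ℤ} (ha : a ≠ 0) :
    ‖(a : ℚ_[p])‖ = (p : ℝ) ^ (-(padicValInt p a : ℝ)) := by
  have h1 : ‖((a : ℚ) : ℚ_[p])‖ = (padicNorm p (a : ℚ) : ℝ) := Padic.eq_padicNorm _
  rw [Rat.cast_intCast] at h1
  rw [h1, padicNorm.eq_zpow_of_nonzero (by exact_mod_cast ha), padicValRat.of_int]
  push_cast
  rw [← Real.rpow_intCast]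
  push_cast
  rfl

theorem one_lt_prime_cast (p : ℕ) [hp : Fact p.Prime] : (1 : ℝ) < p := by
  exact_mod_cast hp.out.one_lt

theorem prime_cast_pos (p : ℕ) [Fact p.Prime] : (0 : ℝ) < p :=
  zero_lt_one.trans (one_lt_prime_cast p)

/-- The columns `w, w + 1, …, w + (m - d) - 1`, where `d` is the degree of `A`. -/
def windowColumn {d m : ℕ} (hm : d ≤ m) {w : ℕ} (hw : w ≤ d) (j : Fin (m - d)) : Fin m :=
  ⟨w + j, by omega⟩

theorem windowColumn_injective {d m : ℕ} (hm : d ≤ m) {w : ℕ} (hw : w ≤ d) :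
    Function.Injective (windowColumn hm hw) := by
  intro i j h
  have := congrArg Fin.val h
  simp only [windowColumn] at this
  ext; omega

/-- The square Toeplitz matrix cut out of the recurrence matrix by `m - d` consecutive columns; all
its diagonal entries are `a_w`. -/
def windowMatrix (S : Type*) [CommRing S] (A : ℤ[X]) {m : ℕ} (hm : A.natDegree ≤ m) {w : ℕ}
    (hw : w ≤ A.natDegree) : Matrix (Fin (m - A.natDegree)) (Fin (m - A.natDegree)) S :=
  ((recurrenceMatrix A m).map (Int.castRingHom S)).submatrix id (windowColumn hm hw)

section Window

variable {p : ℕ} [Fact p.Prime] {A : ℤ[X]} {m : ℕ}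

/-- A supporting line of the Newton polygon, with slope `l`, bounds the entries of the recurrence
matrix by a product of a row weight and a column weight. -/
theorem norm_recurrenceMatrix_le {w : ℕ} {l : ℝ} {i : Fin (m - A.natDegree)} {c : Fin m}
    (h : ∀ n, A.coeff n ≠ 0 → (c : ℕ) = i + n →
      (padicValInt p (A.coeff w) : ℝ) + l * ((n : ℝ) - w) ≤ padicValInt p (A.coeff n)) :
    ‖(recurrenceMatrix A m).map (Int.castRingHom ℚ_[p]) i c‖ ≤
      (p : ℝ) ^ (-(padicValInt p (A.coeff w) : ℝ) + l * ((w : ℝ) + i)) *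
        (p : ℝ) ^ (-(l * (c : ℝ))) := by
  rw [← Real.rpow_add (prime_cast_pos p)]
  simp only [recurrenceMatrix, Matrix.map_apply, Matrix.of_apply, eq_intCast]
  split_ifs with hic
  · obtain ⟨n, hn⟩ := Nat.exists_eq_add_of_le hic
    rw [hn, Nat.add_sub_cancel_left]
    by_cases ha : A.coeff n = 0
    · rw [ha, Int.cast_zero, norm_zero]
      exact (Real.rpow_pos_of_pos (prime_cast_pos p) _).le
    · rw [norm_coeff_eq_rpow ha]
      refine Real.rpow_le_rpow_of_exponent_le (one_lt_prime_cast p).le ?_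
      have := h n ha hn
      push_cast
      linarith
  · rw [Int.cast_zero, norm_zero]
    exact (Real.rpow_pos_of_pos (prime_cast_pos p) _).le

theorem norm_recurrenceMatrix_lt {w : ℕ} {l : ℝ} {i : Fin (m - A.natDegree)} {c : Fin m}
    (h : ∀ n, A.coeff n ≠ 0 → (c : ℕ) = i + n →
      (padicValInt p (A.coeff w) : ℝ) + l * ((n : ℝ) - w) < padicValInt p (A.coeff n)) :
    ‖(recurrenceMatrix A m).map (Int.castRingHom ℚ_[p]) i c‖ <
      (p : ℝ) ^ (-(padicValInt p (A.coeff w) : ℝ) + l * ((w : ℝ) + i)) *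
        (p : ℝ) ^ (-(l * (c : ℝ))) := by
  rw [← Real.rpow_add (prime_cast_pos p)]
  simp only [recurrenceMatrix, Matrix.map_apply, Matrix.of_apply, eq_intCast]
  split_ifs with hic
  · obtain ⟨n, hn⟩ := Nat.exists_eq_add_of_le hic
    rw [hn, Nat.add_sub_cancel_left]
    by_cases ha : A.coeff n = 0
    · rw [ha, Int.cast_zero, norm_zero]
      exact Real.rpow_pos_of_pos (prime_cast_pos p) _
    · rw [norm_coeff_eq_rpow ha]
      refine Real.rpow_lt_rpow_of_exponent_lt (one_lt_prime_cast p) ?_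
      have := h n ha hn
      push_cast
      linarith
  · rw [Int.cast_zero, norm_zero]
    exact Real.rpow_pos_of_pos (prime_cast_pos p) _

theorem windowMatrix_diag (S : Type*) [CommRing S] (hm : A.natDegree ≤ m) {w : ℕ}
    (hw : w ≤ A.natDegree) (i : Fin (m - A.natDegree)) :
    windowMatrix S A hm hw i i = (A.coeff w : S) := by
  simp [windowMatrix, windowColumn, recurrenceMatrix]

theorem rowWeight_mul_columnWeight {w : ℕ} (haw : A.coeff w ≠ 0) (l : ℝ) (i : ℕ) :
    (p : ℝ) ^ (-(padicValInt p (A.coeff w) : ℝ) + l * ((w : ℝ) + i)) *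
      (p : ℝ) ^ (-(l * ((w + i : ℕ) : ℝ))) = ‖(A.coeff w : ℚ_[p])‖ := by
  rw [norm_coeff_eq_rpow haw, ← Real.rpow_add (prime_cast_pos p)]
  congr 1
  push_cast
  ring

theorem prod_rowWeight_mul_columnWeight (hm : A.natDegree ≤ m) {w : ℕ} (hw : w ≤ A.natDegree)
    (haw : A.coeff w ≠ 0) (l : ℝ) :
    (∏ i : Fin (m - A.natDegree),
      (p : ℝ) ^ (-(padicValInt p (A.coeff w) : ℝ) + l * ((w : ℝ) + i))) *
      ∏ j : Fin (m - A.natDegree), (p : ℝ) ^ (-(l * ((windowColumn hm hw j : ℕ) : ℝ))) =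
      ‖(A.coeff w : ℚ_[p])‖ ^ (m - A.natDegree) := by
  rw [← Finset.prod_mul_distrib]
  have h : ∀ i ∈ (Finset.univ : Finset (Fin (m - A.natDegree))),
      (p : ℝ) ^ (-(padicValInt p (A.coeff w) : ℝ) + l * ((w : ℝ) + i)) *
        (p : ℝ) ^ (-(l * ((windowColumn hm hw i : ℕ) : ℝ))) = ‖(A.coeff w : ℚ_[p])‖ :=
    fun i _ => rowWeight_mul_columnWeight haw l i
  rw [Finset.prod_congr rfl h]
  simp

/-- At a point of the Newton polygon that is an end of its face in the direction `l`, the Toeplitz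
matrix is dominated by its diagonal after weighting rows and columns. -/
theorem norm_det_windowMatrix (hm : A.natDegree ≤ m) {w : ℕ} (hw : w ≤ A.natDegree)
    (haw : A.coeff w ≠ 0) {l : ℝ}
    (hsup : ∀ n, A.coeff n ≠ 0 →
      (padicValInt p (A.coeff w) : ℝ) + l * ((n : ℝ) - w) ≤ padicValInt p (A.coeff n))
    (hlt : (∀ n, A.coeff n ≠ 0 → w < n →
        (padicValInt p (A.coeff w) : ℝ) + l * ((n : ℝ) - w) < padicValInt p (A.coeff n)) ∨
      ∀ n, A.coeff n ≠ 0 → n < w →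
        (padicValInt p (A.coeff w) : ℝ) + l * ((n : ℝ) - w) < padicValInt p (A.coeff n)) :
    ‖(windowMatrix ℚ_[p] A hm hw).det‖ = ‖(A.coeff w : ℚ_[p])‖ ^ (m - A.natDegree) := by
  have hpos := fun x : ℝ => Real.rpow_pos_of_pos (prime_cast_pos p) x
  rw [← prod_rowWeight_mul_columnWeight hm hw haw l]
  have hdiag : ∀ i, ‖windowMatrix ℚ_[p] A hm hw i i‖ =
      (p : ℝ) ^ (-(padicValInt p (A.coeff w) : ℝ) + l * ((w : ℝ) + i)) *
        (p : ℝ) ^ (-(l * ((windowColumn hm hw i : ℕ) : ℝ))) := fun i => by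
    rw [windowMatrix_diag]; exact (rowWeight_mul_columnWeight haw l i).symm
  have hle : ∀ i j, ‖windowMatrix ℚ_[p] A hm hw i j‖ ≤
      (p : ℝ) ^ (-(padicValInt p (A.coeff w) : ℝ) + l * ((w : ℝ) + i)) *
        (p : ℝ) ^ (-(l * ((windowColumn hm hw j : ℕ) : ℝ))) := fun i j =>
    norm_recurrenceMatrix_le fun n hn _ => hsup n hn
  rcases hlt with hlt | hlt
  · refine norm_det_eq_of_upper (fun i => hpos _) (fun i => hpos _) hle hdiag fun i j hij =>
      norm_recurrenceMatrix_lt fun n hn hc => hlt n hn ?_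
    simp only [windowColumn, Fin.lt_def, id_eq] at hc hij
    omega
  · refine norm_det_eq_of_lower (fun i => hpos _) (fun i => hpos _) hle hdiag fun i j hij =>
      norm_recurrenceMatrix_lt fun n hn hc => hlt n hn ?_
    simp only [windowColumn, Fin.lt_def, id_eq] at hc hij
    omega

theorem norm_det_windowMatrix_left (h0 : A.coeff 0 ≠ 0) (hm : A.natDegree ≤ m) {k : ℕ}
    (hk : k < newtonEdges p A) :
    ‖(windowMatrix ℚ_[p] A hm (newtonAbscissa_le p A k)).det‖ =
      ‖(A.coeff (newtonAbscissa p A k) : ℚ_[p])‖ ^ (m - A.natDegree) := by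
  obtain ⟨-, h1, h2⟩ := newtonSlope_support h0 hk
  exact norm_det_windowMatrix hm _ (coeff_newtonAbscissa_ne_zero h0 hk.le) h1
    (Or.inr fun n hn h => h2 n hn (Or.inl h))

theorem norm_det_windowMatrix_right (h0 : A.coeff 0 ≠ 0) (hm : A.natDegree ≤ m) {k : ℕ}
    (hk : k < newtonEdges p A) :
    ‖(windowMatrix ℚ_[p] A hm (newtonAbscissa_le p A (k + 1))).det‖ =
      ‖(A.coeff (newtonAbscissa p A (k + 1)) : ℚ_[p])‖ ^ (m - A.natDegree) := by
  obtain ⟨h1, h2⟩ := newtonSlope_support_right h0 hk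
  exact norm_det_windowMatrix hm _ (coeff_newtonAbscissa_ne_zero h0 hk) h1 (Or.inl h2)

theorem det_windowMatrix_ne_zero (h0 : A.coeff 0 ≠ 0) (hm : A.natDegree ≤ m) {k : ℕ}
    (hk : k ≤ newtonEdges p A) :
    (windowMatrix ℚ_[p] A hm (newtonAbscissa_le p A k)).det ≠ 0 := by
  have ha : 0 < ‖(A.coeff (newtonAbscissa p A k) : ℚ_[p])‖ ^ (m - A.natDegree) :=
    pow_pos (norm_pos_iff.mpr (Int.cast_ne_zero.mpr (coeff_newtonAbscissa_ne_zero h0 hk))) _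
  rw [← norm_pos_iff]
  rcases hk.lt_or_eq with hk' | hk'
  · rwa [norm_det_windowMatrix_left h0 hm hk']
  · rcases k with _ | k
    · -- Without edges, the polygon is a point and every line through it is a supporting line.
      have hd : A.natDegree = 0 := by
        rw [← newtonAbscissa_newtonEdges h0 (p := p), ← hk', newtonAbscissa_zero h0]
      have hn : ∀ n, A.coeff n ≠ 0 → n = 0 := fun n hn => by
        have := Polynomial.le_natDegree_of_ne_zero hn; omega
      rw [norm_det_windowMatrix (l := 0) hm _ (coeff_newtonAbscissa_ne_zero h0 hk)]
      · exact ha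
      · intro n h
        rw [hn n h, newtonAbscissa_zero h0]; simp
      · exact Or.inl fun n h h' => by have := hn n h; omega
    · rwa [norm_det_windowMatrix_right h0 hm (by omega)]

/-- A `p`-adic recurrence that vanishes outside a window of `m - d` coordinates is zero as soon as
the corresponding Toeplitz matrix is nonsingular. -/
theorem eq_zero_of_window (hm : A.natDegree ≤ m) {w : ℕ} (hw : w ≤ A.natDegree)
    (hdet : (windowMatrix ℚ_[p] A hm hw).det ≠ 0) {v : Fin m → ℤ_[p]}
    (hv : ((recurrenceMatrix A m).map (Int.castRingHom ℤ_[p])).mulVec v = 0)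
    (hout : ∀ c, (∀ j, windowColumn hm hw j ≠ c) → v c = 0) : v = 0 := by
  have h1 : (windowMatrix ℚ_[p] A hm hw).mulVec (fun j => (v (windowColumn hm hw j) : ℚ_[p])) =
      0 := by
    ext i
    have h2 := congrArg (fun x : ℤ_[p] => (x : ℚ_[p])) (congrFun hv i)
    simp only [Matrix.mulVec, dotProduct, Pi.zero_apply, Matrix.map_apply, PadicInt.coe_sum,
      PadicInt.coe_mul, eq_intCast, PadicInt.coe_intCast, PadicInt.coe_zero] at h2
    rw [Pi.zero_apply, ← h2]
    refine Fintype.sum_of_injective _ (windowColumn_injective hm hw) _ _ (fun c hc => ?_) ?_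
    · rw [hout c fun j hj => hc ⟨j, hj⟩]; simp
    · intro j; simp [windowMatrix]
  have h2 := Matrix.eq_zero_of_mulVec_eq_zero hdet h1
  ext c
  by_cases hc : ∀ j, windowColumn hm hw j ≠ c
  · rw [hout c hc]; rfl
  · push Not at hc
    obtain ⟨j, rfl⟩ := hc
    simpa using congrFun h2 j

/-- The recurrence that is supported on a window and on one further coordinate `c₀`, where it equals
`1`; it is integral if it decays, in the direction `l`, from `c₀` into the window. -/
theorem exists_window_recurrence (hm : A.natDegree ≤ m) {w : ℕ} (hw : w ≤ A.natDegree)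
    (haw : A.coeff w ≠ 0) {l : ℝ}
    (hsup : ∀ n, A.coeff n ≠ 0 →
      (padicValInt p (A.coeff w) : ℝ) + l * ((n : ℝ) - w) ≤ padicValInt p (A.coeff n))
    (hdet : ‖(windowMatrix ℚ_[p] A hm hw).det‖ = ‖(A.coeff w : ℚ_[p])‖ ^ (m - A.natDegree))
    {c₀ : Fin m} (hc₀ : ∀ j, windowColumn hm hw j ≠ c₀)
    (hint : ∀ j, l * ((windowColumn hm hw j : ℕ) - (c₀ : ℕ) : ℝ) ≤ 0) :
    ∃ v : Fin m → ℤ_[p],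
      ((recurrenceMatrix A m).map (Int.castRingHom ℤ_[p])).mulVec v = 0 ∧ v c₀ = 1 ∧
      (∀ c, c ≠ c₀ → (∀ j, windowColumn hm hw j ≠ c) → v c = 0) ∧
      ∀ c, ‖v c‖ ≤ (p : ℝ) ^ (l * ((c : ℕ) - (c₀ : ℕ) : ℝ)) := by
  have hpos := fun x : ℝ => Real.rpow_pos_of_pos (prime_cast_pos p) x
  obtain ⟨u, hu, hu1, hu0, hub⟩ := exists_kernel_vector
    (R := (recurrenceMatrix A m).map (Int.castRingHom ℚ_[p]))
    (r := fun i => (p : ℝ) ^ (-(padicValInt p (A.coeff w) : ℝ) + l * ((w : ℝ) + (i : ℕ))))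
    (q := fun c => (p : ℝ) ^ (-(l * ((c : ℕ) : ℝ))))
    (fun i => hpos _) (fun c => hpos _)
    (fun i c => norm_recurrenceMatrix_le fun n hn _ => hsup n hn)
    (windowColumn_injective hm hw)
    (hdet.trans (prod_rowWeight_mul_columnWeight hm hw haw l).symm) hc₀
  have hub' : ∀ c, ‖u c‖ ≤ (p : ℝ) ^ (l * ((c : ℕ) - (c₀ : ℕ) : ℝ)) := fun c => by
    refine (hub c).trans_eq ?_
    rw [← Real.rpow_sub (prime_cast_pos p)]
    congr 1; ring
  have hu_int : ∀ c, ‖u c‖ ≤ 1 := by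
    intro c
    by_cases h : c = c₀
    · rw [h, hu1, norm_one]
    · by_cases h' : ∀ j, windowColumn hm hw j ≠ c
      · rw [hu0 c h h', norm_zero]; exact zero_le_one
      · push Not at h'
        obtain ⟨j, rfl⟩ := h'
        exact (hub' _).trans
          (Real.rpow_le_one_of_one_le_of_nonpos (one_lt_prime_cast p).le (hint j))
  obtain ⟨v, hv⟩ : ∃ v : Fin m → ℤ_[p], ∀ c, (v c : ℚ_[p]) = u c :=
    ⟨fun c => ⟨u c, hu_int c⟩, fun c => rfl⟩
  refine ⟨v, ?_, PadicInt.ext ((hv _).trans hu1),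
    fun c h h' => PadicInt.ext ((hv _).trans (hu0 c h h')), fun c => ?_⟩
  · funext i
    apply PadicInt.ext
    have := congrFun hu i
    simp only [Matrix.mulVec, dotProduct, Pi.zero_apply, Matrix.map_apply, eq_intCast] at this ⊢
    rw [PadicInt.coe_sum, PadicInt.coe_zero, ← this]
    exact Finset.sum_congr rfl fun c _ => by rw [PadicInt.coe_mul, PadicInt.coe_intCast, hv]
  · rw [PadicInt.norm_def, hv]
    exact hub' c

end Window

/-! ### Rows attached to the edges of the Newton polygon -/

theorem le_valuation_of_norm_le {p : ℕ} [Fact p.Prime] {x : ℤ_[p]} (hx : x ≠ 0) {y : ℝ}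
    (h : ‖x‖ ≤ (p : ℝ) ^ (-y)) : y ≤ x.valuation := by
  rw [PadicInt.norm_eq_zpow_neg_valuation hx, ← Real.rpow_intCast,
    Real.rpow_le_rpow_left_iff (one_lt_prime_cast p)] at h
  push_cast at h
  linarith

theorem ne_zero_and_valuation_eq_of_norm_eq {p : ℕ} [Fact p.Prime] {x : ℤ_[p]} {y : ℝ}
    (h : ‖x‖ = (p : ℝ) ^ (-y)) : x ≠ 0 ∧ (x.valuation : ℝ) = y := by
  have hx : x ≠ 0 := by
    rw [← norm_pos_iff, h]; exact Real.rpow_pos_of_pos (prime_cast_pos p) _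
  refine ⟨hx, le_antisymm ?_ (le_valuation_of_norm_le hx h.le)⟩
  rw [PadicInt.norm_eq_zpow_neg_valuation hx, ← Real.rpow_intCast] at h
  have := (Real.rpow_le_rpow_left_iff (one_lt_prime_cast p)).mp h.symm.le
  push_cast at this
  linarith

theorem newtonSlope_mul_length {p : ℕ} {A : ℤ[X]} {m : ℕ} (h0 : A.coeff 0 ≠ 0)
    (hm : A.natDegree ≤ m) {k : ℕ} (hk : k < newtonEdges p A) :
    (newtonSlope p A k : ℝ) * newtonLength p A k * ((m : ℝ) - A.natDegree) =
      ((padicValInt p (A.coeff (newtonAbscissa p A (k + 1))) : ℝ) -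
        padicValInt p (A.coeff (newtonAbscissa p A k))) * (m - A.natDegree : ℕ) := by
  rw [(newtonSlope_support h0 hk).1, newtonLength,
    Nat.cast_sub (newtonAbscissa_lt h0 (Nat.lt_succ_self k) hk).le, Nat.cast_sub hm]
  ring

/-- The properties of row `j`, an index of block `k`: it is a `p`-adic recurrence supported between
the left end of block `k` of the left square and the right end of block `k` of the right square; it
is a unit vector on the left block if `k < s`, on the right block if `s ≤ k`, and it decays from the
unit entry with the slope of the edge. -/
structure IsEdgeRow (p : ℕ) [Fact p.Prime] (A : ℤ[X]) {m : ℕ} (s k j : ℕ) (v : Fin m → ℤ_[p]) :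
    Prop where
  recurrence : ((recurrenceMatrix A m).map (Int.castRingHom ℤ_[p])).mulVec v = 0
  zero_left : ∀ c : Fin m, (c : ℕ) < newtonAbscissa p A k → v c = 0
  zero_right : ∀ c : Fin m, newtonAbscissa p A (k + 1) + (m - A.natDegree) ≤ c → v c = 0
  unit_left : k < s → ∀ c : Fin m, (c : ℕ) < newtonAbscissa p A (k + 1) →
    v c = if (c : ℕ) = j then 1 else 0
  unit_right : s ≤ k → ∀ c : Fin m, newtonAbscissa p A k + (m - A.natDegree) ≤ c →
    v c = if (c : ℕ) = j + (m - A.natDegree) then 1 else 0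
  bound_left : k < s → ∀ c : Fin m, ‖v c‖ ≤ (p : ℝ) ^ ((newtonSlope p A k : ℝ) * ((c : ℝ) - j))
  bound_right : s ≤ k → ∀ c : Fin m,
    ‖v c‖ ≤ (p : ℝ) ^ ((newtonSlope p A k : ℝ) * ((c : ℝ) - (j + (m - A.natDegree) : ℕ)))

section Rows

variable {p : ℕ} [Fact p.Prime] {A : ℤ[X]} {m s : ℕ}

/-- The window for the unknowns ends at the right end of the edge if the unit entry stands on the
left, and begins at the left end of the edge if it stands on the right. -/
theorem exists_isEdgeRow (h0 : A.coeff 0 ≠ 0) (hm : A.natDegree ≤ m) {k : ℕ}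
    (hk : k < newtonEdges p A) (hneg : k < s → newtonSlope p A k ≤ 0)
    (hpos : s ≤ k → 0 ≤ newtonSlope p A k) (a : Fin (newtonLength p A k)) :
    ∃ v : Fin m → ℤ_[p], IsEdgeRow p A s k (blockIndex p A k a) v := by
  obtain ⟨ha1, ha2⟩ := blockIndex_bounds a
  have hj := (blockIndex p A k a).isLt
  have hw1 := newtonAbscissa_le p A (k + 1)
  generalize (blockIndex p A k a : ℕ) = j at ha1 ha2 hj
  have hout : ∀ {w : ℕ} (hw : w ≤ A.natDegree) (c : Fin m),
      ((c : ℕ) < w ∨ w + (m - A.natDegree) ≤ c) → ∀ i, windowColumn hm hw i ≠ c := by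
    rintro w hw c h i rfl
    simp only [windowColumn] at h
    omega
  by_cases hks : k < s
  · have hw := newtonAbscissa_le p A (k + 1)
    obtain ⟨v, hv, hv1, hv0, hvb⟩ := exists_window_recurrence (c₀ := ⟨j, by omega⟩) hm hw
      (coeff_newtonAbscissa_ne_zero h0 hk) (newtonSlope_support_right h0 hk).1
      (norm_det_windowMatrix_right h0 hm hk) (hout hw _ (Or.inl ha2)) (fun i => by
        refine mul_nonpos_of_nonpos_of_nonneg (by exact_mod_cast hneg hks) (sub_nonneg.mpr ?_)
        simp only [windowColumn, Nat.cast_le]; omega)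
    have hz : ∀ c : Fin m, (c : ℕ) ≠ j → ((c : ℕ) < newtonAbscissa p A (k + 1) ∨
        newtonAbscissa p A (k + 1) + (m - A.natDegree) ≤ c) → v c = 0 := fun c hc h =>
      hv0 c (fun h' => hc (congrArg Fin.val h')) (hout hw c h)
    refine ⟨v, hv, fun c hc => hz c (by omega) (Or.inl (by omega)),
      fun c hc => hz c (by omega) (Or.inr hc), fun _ c hc => ?_, fun h => absurd hks (by omega),
      fun _ => hvb, fun h => absurd hks (by omega)⟩
    split_ifs with h
    · exact (congrArg v (Fin.ext h)).trans hv1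
    · exact hz c h (Or.inl hc)
  · have hw := newtonAbscissa_le p A k
    have hsup := newtonSlope_support h0 hk
    obtain ⟨v, hv, hv1, hv0, hvb⟩ := exists_window_recurrence
      (c₀ := ⟨j + (m - A.natDegree), by omega⟩) hm hw
      (coeff_newtonAbscissa_ne_zero h0 hk.le) hsup.2.1
      (norm_det_windowMatrix_left h0 hm hk) (hout hw _ (Or.inr (by simp only; omega))) (fun i => by
        refine mul_nonpos_of_nonneg_of_nonpos (by exact_mod_cast hpos (by omega))
          (sub_nonpos.mpr ?_)
        simp only [windowColumn, Nat.cast_le]; omega)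
    have hz : ∀ c : Fin m, (c : ℕ) ≠ j + (m - A.natDegree) → ((c : ℕ) < newtonAbscissa p A k ∨
        newtonAbscissa p A k + (m - A.natDegree) ≤ c) → v c = 0 := fun c hc h =>
      hv0 c (fun h' => hc (congrArg Fin.val h')) (hout hw c h)
    refine ⟨v, hv, fun c hc => hz c (by omega) (Or.inl (by omega)),
      fun c hc => hz c (by omega) (Or.inr (by omega)), fun h => absurd h hks, fun _ c hc => ?_,
      fun h => absurd h hks, fun _ => hvb⟩
    split_ifs with h
    · exact (congrArg v (Fin.ext h)).trans hv1
    · exact hz c h (Or.inr hc)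

/-- The minors of the rows of one block on its left and right columns are complementary, inside the
columns that support these rows, to the Toeplitz matrices at the two ends of the edge. -/
theorem norm_det_newtonBlock (h0 : A.coeff 0 ≠ 0) (hm : A.natDegree ≤ m) {k : ℕ}
    (hk : k < newtonEdges p A) {M : Matrix (Fin A.natDegree) (Fin m) ℤ_[p]}
    (hM : ∀ a, IsEdgeRow p A s k (blockIndex p A k a) (M (blockIndex p A k a))) :
    ‖(A.coeff (newtonAbscissa p A k) : ℚ_[p])‖ ^ (m - A.natDegree) *
        ‖(newtonBlock p A (leftSquare hm M) k k).det‖ =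
      ‖(A.coeff (newtonAbscissa p A (k + 1)) : ℚ_[p])‖ ^ (m - A.natDegree) *
        ‖(newtonBlock p A (rightSquare hm M) k k).det‖ := by
  have hlt : newtonAbscissa p A k < newtonAbscissa p A (k + 1) :=
    newtonAbscissa_lt h0 (Nat.lt_succ_self k) hk
  have hw1 := newtonAbscissa_le p A (k + 1)
  have hlen : newtonLength p A k = newtonAbscissa p A (k + 1) - newtonAbscissa p A k := rfl
  rw [← norm_det_windowMatrix_left h0 hm hk, ← norm_det_windowMatrix_right h0 hm hk]
  let col : Fin (m - A.natDegree + newtonLength p A k) → Fin m := fun x =>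
    ⟨newtonAbscissa p A k + x, by have := x.isLt; omega⟩
  have hcol : Function.Injective col := fun x y h => by
    have := congrArg Fin.val h
    simp only [col] at this
    ext; omega
  let R : Matrix (Fin (m - A.natDegree)) (Fin (m - A.natDegree + newtonLength p A k)) ℚ_[p] :=
    ((recurrenceMatrix A m).map (Int.castRingHom ℚ_[p])).submatrix id col
  let N : Matrix (Fin (newtonLength p A k)) (Fin (m - A.natDegree + newtonLength p A k)) ℚ_[p] :=
    (M.map PadicInt.Coe.ringHom).submatrix (blockIndex p A k) col
  have hRN : R * N.transpose = 0 := by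
    ext i a
    have h2 := congrArg (fun x : ℤ_[p] => (x : ℚ_[p])) (congrFun (hM a).recurrence i)
    simp only [Matrix.mulVec, dotProduct, Pi.zero_apply, Matrix.map_apply, PadicInt.coe_sum,
      PadicInt.coe_mul, eq_intCast, PadicInt.coe_intCast, PadicInt.coe_zero] at h2
    rw [Matrix.zero_apply, ← h2]
    refine Fintype.sum_of_injective col hcol _ _ (fun c hc => ?_) fun x => rfl
    suffices M (blockIndex p A k a) c = 0 by rw [this]; simp
    by_cases hc1 : (c : ℕ) < newtonAbscissa p A k
    · exact (hM a).zero_left c hc1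
    · refine (hM a).zero_right c ?_
      by_contra! hc2
      exact hc ⟨⟨c - newtonAbscissa p A k, by omega⟩, Fin.ext (by simp only [col]; omega)⟩
  obtain ⟨ε, hε⟩ := det_mul_det_complementary hRN finSumFinEquiv
    ((Equiv.sumComm _ _).trans (finSumFinEquiv.trans (finCongr (Nat.add_comm _ _))))
  have e1 : R.submatrix id (finSumFinEquiv ∘ Sum.inl) =
      windowMatrix ℚ_[p] A hm (newtonAbscissa_le p A k) := rfl
  have e2 : R.submatrix id (((Equiv.sumComm _ _).trans
      (finSumFinEquiv.trans (finCongr (Nat.add_comm _ _)))) ∘ Sum.inl) =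
      windowMatrix ℚ_[p] A hm (newtonAbscissa_le p A (k + 1)) := by
    ext i j
    simp only [R, windowMatrix, Matrix.submatrix_apply, id_eq]
    congr 1
    ext
    simp [col, windowColumn]
    omega
  have e3 : N.submatrix id (((Equiv.sumComm _ _).trans
      (finSumFinEquiv.trans (finCongr (Nat.add_comm _ _)))) ∘ Sum.inr) =
      (newtonBlock p A (leftSquare hm M) k k).map PadicInt.Coe.ringHom := by
    ext i j
    simp only [N, newtonBlock, leftSquare, Matrix.submatrix_apply, Matrix.map_apply, id_eq]
    congr 2
  have e4 : N.submatrix id (finSumFinEquiv ∘ Sum.inr) =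
      (newtonBlock p A (rightSquare hm M) k k).map PadicInt.Coe.ringHom := by
    ext i j
    simp only [N, newtonBlock, rightSquare, Matrix.submatrix_apply, Matrix.map_apply, id_eq]
    congr 2
    ext
    simp [col, blockIndex]
    omega
  have hε1 : ‖((ε : ℤ) : ℚ_[p])‖ = 1 := by
    rcases Int.units_eq_one_or ε with h | h <;> simp [h]
  have hcoe : ∀ {ι : Type} [Fintype ι] [DecidableEq ι] (X : Matrix ι ι ℤ_[p]),
      ‖(X.map PadicInt.Coe.ringHom).det‖ = ‖X.det‖ := by
    intro ι _ _ X
    rw [← RingHom.mapMatrix_apply, ← RingHom.map_det]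
    rfl
  rw [e1, e2, e3, e4] at hε
  have := congrArg norm hε
  rwa [norm_mul, norm_mul, norm_mul, hε1, one_mul, hcoe, hcoe] at this

theorem norm_coeff_pow_eq_rpow {a : ℤ} (ha : a ≠ 0) (n : ℕ) :
    ‖(a : ℚ_[p])‖ ^ n = (p : ℝ) ^ (-((padicValInt p a : ℝ) * n)) := by
  rw [norm_coeff_eq_rpow ha, ← Real.rpow_natCast, ← Real.rpow_mul (prime_cast_pos p).le]
  congr 1; ring

theorem hasNewtonShape_of_isEdgeRow (h0 : A.coeff 0 ≠ 0) (hm : A.natDegree ≤ m)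
    (hs : s ≤ newtonEdges p A) {M : Matrix (Fin A.natDegree) (Fin m) ℤ_[p]}
    (hM : ∀ k < newtonEdges p A, ∀ a,
      IsEdgeRow p A s k (blockIndex p A k a) (M (blockIndex p A k a))) :
    HasNewtonShape p A hm s M := by
  have hleft : ∀ k < s, newtonBlock p A (leftSquare hm M) k k = 1 := by
    intro k hk
    ext a b
    have hb := blockIndex_bounds b
    rw [Matrix.one_apply]
    refine ((hM k (by omega) a).unit_left hk _ hb.2).trans (if_congr ?_ rfl rfl)
    rw [← (blockIndex_injective (p := p) (A := A) (k := k)).eq_iff, Fin.ext_iff]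
    exact eq_comm
  have hright : ∀ k, s ≤ k → k < newtonEdges p A →
      newtonBlock p A (rightSquare hm M) k k = 1 := by
    intro k hsk hk
    ext a b
    have hb := blockIndex_bounds b
    rw [Matrix.one_apply]
    refine ((hM k hk a).unit_right hsk _ (by simp only; omega)).trans (if_congr ?_ rfl rfl)
    rw [← (blockIndex_injective (p := p) (A := A) (k := k)).eq_iff, Fin.ext_iff]
    simp only; omega
  refine ⟨?_, ?_, hleft, hright, ?_, ?_, ?_, ?_⟩
  · intro k l hk hl
    ext a b
    have hb := blockIndex_bounds b
    have := newtonAbscissa_mono h0 (show l + 1 ≤ k from hl) hk.le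
    exact (hM k hk a).zero_left _ (hb.2.trans_le this)
  · intro k l hl hk
    ext a b
    have hb := blockIndex_bounds b
    have := newtonAbscissa_mono h0 (show k + 1 ≤ l from hk) hl.le
    exact (hM k (hk.trans hl) a).zero_right _ (by simp only; omega)
  · intro k hk
    have hkr : k < newtonEdges p A := by omega
    have h1 := norm_det_newtonBlock h0 hm hkr (hM k hkr)
    rw [hleft k hk, Matrix.det_one, norm_one, mul_one,
      norm_coeff_pow_eq_rpow (coeff_newtonAbscissa_ne_zero h0 hkr.le),
      norm_coeff_pow_eq_rpow (coeff_newtonAbscissa_ne_zero h0 hkr),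
      mul_comm _ ‖_‖, ← div_eq_iff (Real.rpow_pos_of_pos (prime_cast_pos p) _).ne',
      ← Real.rpow_sub (prime_cast_pos p)] at h1
    have h2 := newtonSlope_mul_length h0 hm hkr
    obtain ⟨h3, h4⟩ := ne_zero_and_valuation_eq_of_norm_eq
      (y := -(newtonSlope p A k : ℝ) * newtonLength p A k * ((m : ℝ) - A.natDegree))
      (h1.symm.trans (by congr 1; linarith))
    exact ⟨h3, by exact_mod_cast h4⟩
  · intro k hsk hkr
    have h1 := norm_det_newtonBlock h0 hm hkr (hM k hkr)
    rw [hright k hsk hkr, Matrix.det_one, norm_one, mul_one,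
      norm_coeff_pow_eq_rpow (coeff_newtonAbscissa_ne_zero h0 hkr.le),
      norm_coeff_pow_eq_rpow (coeff_newtonAbscissa_ne_zero h0 hkr),
      mul_comm, ← eq_div_iff (Real.rpow_pos_of_pos (prime_cast_pos p) _).ne',
      ← Real.rpow_sub (prime_cast_pos p)] at h1
    have h2 := newtonSlope_mul_length h0 hm hkr
    obtain ⟨h3, h4⟩ := ne_zero_and_valuation_eq_of_norm_eq
      (y := (newtonSlope p A k : ℝ) * newtonLength p A k * ((m : ℝ) - A.natDegree))
      (h1.trans (by congr 1; linarith))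
    exact ⟨h3, by exact_mod_cast h4⟩
  · intro k hk a t c hc hne
    have h1 := (hM k (by omega) a).bound_left hk c
    rw [hc] at h1
    have := le_valuation_of_norm_le (y := -(t : ℝ) * newtonSlope p A k) hne
      (h1.trans_eq (by congr 1; push_cast; ring))
    exact_mod_cast this
  · intro k hsk hk a t c hc hne
    have h1 := (hM k hk a).bound_right hsk c
    rw [← hc] at h1
    have := le_valuation_of_norm_le (y := (t : ℝ) * newtonSlope p A k) hne
      (h1.trans_eq (by congr 1; push_cast; ring))
    exact_mod_cast this

/-! ### Existence of the basis -/

theorem recurrenceVector_apply (b : ℤ_[p] ⊗[ℤ] recurrenceModule A m) (c : Fin m) :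
    recurrenceVector p A m b c = recurrenceCoord p A m c b := rfl

/-- Rows that form a unimodular matrix on a set of columns which determines every recurrence are the
rows of a basis. -/
theorem exists_basis_rowMatrix_eq {M : Matrix (Fin A.natDegree) (Fin m) ℤ_[p]}
    (hM : ∀ j, ((recurrenceMatrix A m).map (Int.castRingHom ℤ_[p])).mulVec (M j) = 0)
    {c : Fin A.natDegree → Fin m} (hdet : IsUnit (M.submatrix id c).det)
    (hinj : ∀ v : Fin m → ℤ_[p],
      ((recurrenceMatrix A m).map (Int.castRingHom ℤ_[p])).mulVec v = 0 →
      (∀ j, v (c j) = 0) → v = 0) :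
    ∃ b : Module.Basis (Fin A.natDegree) ℤ_[p] (ℤ_[p] ⊗[ℤ] recurrenceModule A m),
      rowMatrix p A m b = M := by
  choose f hf using fun j => exists_recurrenceVector_eq_iff.mpr (hM j)
  have hsum : ∀ (g : Fin A.natDegree → ℤ_[p]) (j : Fin A.natDegree),
      recurrenceVector p A m (∑ i, g i • f i) (c j) =
        Matrix.vecMul g (M.submatrix id c) j := by
    intro g j
    simp [Matrix.vecMul, dotProduct, hf]
  have hli : LinearIndependent ℤ_[p] f := by
    rw [Fintype.linearIndependent_iff]
    intro g hg
    refine congrFun (Matrix.eq_zero_of_vecMul_eq_zero hdet.ne_zero (v := g) ?_)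
    ext j
    rw [← hsum, hg, map_zero]; rfl
  have hspan : ⊤ ≤ Submodule.span ℤ_[p] (Set.range f) := by
    intro z _
    set g := Matrix.vecMul (fun j => recurrenceVector p A m z (c j)) (M.submatrix id c)⁻¹ with hg
    have hz : z = ∑ i, g i • f i := by
      rw [← sub_eq_zero]
      refine recurrenceVector_injective p A m (Eq.trans ?_ (map_zero _).symm)
      refine hinj _ (exists_recurrenceVector_eq_iff.mp ⟨_, rfl⟩) fun j => ?_
      rw [map_sub, Pi.sub_apply, hsum, hg, Matrix.vecMul_vecMul, Matrix.nonsing_inv_mul _ hdet,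
        Matrix.vecMul_one, sub_self]
    rw [hz]
    exact Submodule.sum_mem _ fun i _ =>
      Submodule.smul_mem _ _ (Submodule.subset_span ⟨i, rfl⟩)
  refine ⟨Module.Basis.mk hli hspan, ?_⟩
  ext i j
  simp only [rowMatrix, Matrix.of_apply, Module.Basis.mk_apply]
  rw [← recurrenceVector_apply, hf]

theorem exists_basis_hasNewtonShape (h0 : A.coeff 0 ≠ 0) (hm : A.natDegree ≤ m)
    (hs : s ≤ newtonEdges p A) (hneg : ∀ k < s, newtonSlope p A k ≤ 0)
    (hpos : ∀ k, s ≤ k → k < newtonEdges p A → 0 ≤ newtonSlope p A k) :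
    ∃ b : Module.Basis (Fin A.natDegree) ℤ_[p] (ℤ_[p] ⊗[ℤ] recurrenceModule A m),
      HasNewtonShape p A hm s (rowMatrix p A m b) := by
  have hrow : ∀ j : Fin A.natDegree, ∃ v : Fin m → ℤ_[p], ∀ k < newtonEdges p A, ∀ a,
      blockIndex p A k a = j → IsEdgeRow p A s k j v := by
    intro j
    obtain ⟨k, hk, a, rfl⟩ := exists_blockIndex_eq (p := p) h0 j
    obtain ⟨v, hv⟩ := exists_isEdgeRow (s := s) h0 hm hk (hneg k) (fun h => hpos k h hk) a
    refine ⟨v, fun l hl b hb => ?_⟩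
    obtain rfl := eq_of_blockIndex_eq h0 hl hk hb
    exact hv
  obtain ⟨M, hM⟩ : ∃ M : Matrix (Fin A.natDegree) (Fin m) ℤ_[p], ∀ j, ∀ k < newtonEdges p A, ∀ a,
      blockIndex p A k a = j → IsEdgeRow p A s k j (M j) := by
    choose M hM using hrow
    exact ⟨M, hM⟩
  have hrows : ∀ k < newtonEdges p A, ∀ a,
      IsEdgeRow p A s k (blockIndex p A k a) (M (blockIndex p A k a)) :=
    fun k hk a => hM _ k hk a rfl
  set w := newtonAbscissa p A s with hw
  have hwd : w ≤ A.natDegree := newtonAbscissa_le p A s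
  let c : Fin A.natDegree → Fin m := fun j =>
    ⟨if (j : ℕ) < w then j else j + (m - A.natDegree), by split_ifs <;> omega⟩
  have hrange : ∀ x : Fin m, (∀ j, windowColumn hm hwd j ≠ x) → ∃ j, c j = x := by
    intro x hx
    by_cases h1 : (x : ℕ) < w
    · exact ⟨⟨x, by omega⟩, Fin.ext (by simp [c, h1])⟩
    · have h2 : w + (m - A.natDegree) ≤ x := by
        by_contra! h2
        exact hx ⟨x - w, by omega⟩ (Fin.ext (by simp only [windowColumn]; omega))
      refine ⟨⟨x - (m - A.natDegree), by omega⟩, Fin.ext ?_⟩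
      simp only [c]
      rw [if_neg (by omega)]
      omega
  have hlow : ∀ k a, k < s → (blockIndex p A k a : ℕ) < w := fun k a hk =>
    (blockIndex_bounds a).2.trans_le (newtonAbscissa_mono h0 (show k + 1 ≤ s from hk) hs)
  have hhigh : ∀ k a, s ≤ k → k < newtonEdges p A → w ≤ blockIndex p A k a := fun k a hk hkr =>
    (newtonAbscissa_mono h0 hk hkr.le).trans (blockIndex_bounds a).1
  -- On the columns `c`, the matrix is unitriangular for the order in which the rows of the blocks
  -- `k ≥ s` come first and in reverse.
  have hdet : (M.submatrix id c).det = 1 := by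
    refine det_eq_one_of_blockTriangular_injective
      (b := fun j : Fin A.natDegree => if (j : ℕ) < w then (j : ℤ) else -(j : ℤ) - 1) ?_ ?_ ?_
    · intro i j hij
      simp only at hij
      ext
      split_ifs at hij <;> omega
    · intro i j hij
      obtain ⟨k, hk, a, rfl⟩ := exists_blockIndex_eq (p := p) h0 i
      have hb := blockIndex_bounds a
      simp only [Matrix.submatrix_apply, id_eq] at hij ⊢
      rcases lt_or_ge k s with hks | hks
      · have hi := hlow k a hks
        have h1 := newtonAbscissa_mono h0 (show k + 1 ≤ s from hks) hs
        rw [if_pos hi] at hij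
        by_cases hj : (j : ℕ) < w
        · rw [if_pos hj] at hij
          rw [(hrows k hk a).unit_left hks _ (by simp only [c, if_pos hj]; omega),
            if_neg (by simp only [c, if_pos hj]; omega)]
        · exact (hrows k hk a).zero_right _ (by simp only [c, if_neg hj]; omega)
      · have hi := hhigh k a hks hk
        have h1 := newtonAbscissa_mono h0 hks hk.le
        rw [if_neg (not_lt.mpr hi)] at hij
        by_cases hj : (j : ℕ) < w
        · exact (hrows k hk a).zero_left _ (by simp only [c, if_pos hj]; omega)
        · rw [if_neg hj] at hij
          rw [(hrows k hk a).unit_right hks _ (by simp only [c, if_neg hj]; omega),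
            if_neg (by simp only [c, if_neg hj]; omega)]
    · intro i
      obtain ⟨k, hk, a, rfl⟩ := exists_blockIndex_eq (p := p) h0 i
      have hb := blockIndex_bounds a
      simp only [Matrix.submatrix_apply, id_eq]
      rcases lt_or_ge k s with hks | hks
      · have hi := hlow k a hks
        rw [(hrows k hk a).unit_left hks _ (by simp only [c, if_pos hi]; omega),
          if_pos (by simp only [c, if_pos hi])]
      · have hi := not_lt.mpr (hhigh k a hks hk)
        rw [(hrows k hk a).unit_right hks _ (by simp only [c, if_neg hi]; omega),
          if_pos (by simp only [c, if_neg hi])]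
  obtain ⟨b, hb⟩ := exists_basis_rowMatrix_eq (M := M) (c := c) (fun j => by
      obtain ⟨k, hk, a, rfl⟩ := exists_blockIndex_eq (p := p) h0 j
      exact (hrows k hk a).recurrence) (by rw [hdet]; exact isUnit_one)
    (fun v hv hvc => eq_zero_of_window hm hwd (det_windowMatrix_ne_zero h0 hm hs) hv
      fun x hx => by obtain ⟨j, rfl⟩ := hrange x hx; exact hvc j)
  exact ⟨b, by rw [hb]; exact hasNewtonShape_of_isEdgeRow h0 hm hs hrows⟩

end Rows

/-! ### Uniqueness of the basis -/

theorem exists_newtonBlock_eq_submatrix {p : ℕ} {A : ℤ[X]} {S : Type*} {β : Fin A.natDegree → ℕ}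
    (hβ : ∀ j, β j < newtonEdges p A ∧ ∃ a, blockIndex p A (β j) a = j)
    (hβ' : ∀ k < newtonEdges p A, ∀ a, β (blockIndex p A k a) = k) {k : ℕ}
    (hk : k < newtonEdges p A) :
    ∃ e : Fin (newtonLength p A k) ≃ {j // β j = k}, ∀ N : Matrix _ _ S,
      newtonBlock p A N k k = (N.toSquareBlock β k).submatrix e e := by
  refine ⟨Equiv.ofBijective (fun a => ⟨blockIndex p A k a, hβ' k hk a⟩)
    ⟨fun a b h => blockIndex_injective (congrArg Subtype.val h), ?_⟩, fun N => rfl⟩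
  rintro ⟨j, rfl⟩
  obtain ⟨-, a, ha⟩ := hβ j
  exact ⟨a, Subtype.ext ha⟩

section Uniqueness

variable {p : ℕ} {A : ℤ[X]} {R : Type*} [CommRing R]

open Matrix

theorem exists_blockNumber (h0 : A.coeff 0 ≠ 0) :
    ∃ β : Fin A.natDegree → ℕ, (∀ j, β j < newtonEdges p A ∧ ∃ a, blockIndex p A (β j) a = j) ∧
      ∀ k < newtonEdges p A, ∀ a, β (blockIndex p A k a) = k := by
  choose β hβ hβ' using fun j => exists_blockIndex_eq (p := p) h0 j
  refine ⟨β, fun j => ⟨hβ j, hβ' j⟩, fun k hk a => ?_⟩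
  obtain ⟨b, hb⟩ := hβ' (blockIndex p A k a)
  exact eq_of_blockIndex_eq h0 (hβ _) hk hb

theorem toSquareBlock_eq_one {β : Fin A.natDegree → ℕ}
    (hβ : ∀ j, β j < newtonEdges p A ∧ ∃ a, blockIndex p A (β j) a = j)
    (hβ' : ∀ k < newtonEdges p A, ∀ a, β (blockIndex p A k a) = k) {k : ℕ}
    (hk : k < newtonEdges p A) {N : Matrix (Fin A.natDegree) (Fin A.natDegree) R}
    (h : newtonBlock p A N k k = 1) : N.toSquareBlock β k = 1 := by
  obtain ⟨e, he⟩ := exists_newtonBlock_eq_submatrix (S := R) hβ hβ' hk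
  rw [he] at h
  have := congrArg (fun X => X.submatrix e.symm e.symm) h
  simpa using this

theorem det_toSquareBlock_ne_zero [Nontrivial R] {β : Fin A.natDegree → ℕ}
    (hβ : ∀ j, β j < newtonEdges p A ∧ ∃ a, blockIndex p A (β j) a = j)
    (hβ' : ∀ k < newtonEdges p A, ∀ a, β (blockIndex p A k a) = k)
    {N : Matrix (Fin A.natDegree) (Fin A.natDegree) R}
    (h : ∀ k < newtonEdges p A, (newtonBlock p A N k k).det ≠ 0) (k : ℕ) :
    (N.toSquareBlock β k).det ≠ 0 := by
  by_cases hk : k < newtonEdges p A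
  · obtain ⟨e, he⟩ := exists_newtonBlock_eq_submatrix (S := R) hβ hβ' hk
    have := h k hk
    rwa [he, det_submatrix_equiv_self] at this
  · have : IsEmpty {j // β j = k} := ⟨fun j => hk (j.2 ▸ (hβ j.1).1)⟩
    rw [det_isEmpty]
    exact one_ne_zero

/-- The transition matrix between two bases of Newton shape is block upper triangular by the left
squares, block lower triangular by the right squares, and its diagonal blocks are identities because
in each block one of the two squares has identity blocks. -/
theorem eq_one_of_mul_hasNewtonShape [Fact p.Prime] (h0 : A.coeff 0 ≠ 0) {m s : ℕ}
    (hm : A.natDegree ≤ m)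
    {M M' : Matrix (Fin A.natDegree) (Fin m) ℤ_[p]}
    (hM : HasNewtonShape p A hm s M) (hM' : HasNewtonShape p A hm s M')
    {G : Matrix (Fin A.natDegree) (Fin A.natDegree) ℤ_[p]} (hG : G * M = M') : G = 1 := by
  obtain ⟨β, hβ, hβ'⟩ := exists_blockNumber (p := p) h0
  have hupper : ∀ {M}, HasNewtonShape p A hm s M → BlockTriangular (leftSquare hm M) β := by
    intro M hM i j hij
    obtain ⟨hi, a, ha⟩ := hβ i
    obtain ⟨hj, b, hb⟩ := hβ j
    have := congrFun (congrFun (hM.left_upper _ _ hi hij) a) b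
    simpa only [newtonBlock, submatrix_apply, ha, hb, Matrix.zero_apply] using this
  have hlower : ∀ {M}, HasNewtonShape p A hm s M →
      BlockTriangular (rightSquare hm M) (OrderDual.toDual ∘ β) := by
    intro M hM i j hij
    have hij : β i < β j := hij
    obtain ⟨hi, a, ha⟩ := hβ i
    obtain ⟨hj, b, hb⟩ := hβ j
    have := congrFun (congrFun (hM.right_lower _ _ hj hij) a) b
    simpa only [newtonBlock, submatrix_apply, ha, hb, Matrix.zero_apply] using this
  have hL : G * leftSquare hm M = leftSquare hm M' := by
    rw [← hG]; rfl
  have hR : G * rightSquare hm M = rightSquare hm M' := by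
    rw [← hG]; rfl
  have hGu : BlockTriangular G β := blockTriangular_of_mul_eq (hupper hM) (hupper hM')
    (det_toSquareBlock_ne_zero hβ hβ' fun k hk => by
      rcases lt_or_ge k s with h | h
      · rw [hM.left_one k h, det_one]; exact one_ne_zero
      · exact (hM.left_det k h hk).1) hL
  have hGl : BlockTriangular G (OrderDual.toDual ∘ β) :=
    blockTriangular_of_mul_eq (hlower hM) (hlower hM')
    (det_toSquareBlock_ne_zero hβ hβ' fun k hk => by
      rcases lt_or_ge k s with h | h
      · exact (hM.right_det k h).1
      · rw [hM.right_one k h hk, det_one]; exact one_ne_zero) hR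
  have hdiag : ∀ k < newtonEdges p A, G.toSquareBlock β k = 1 := by
    intro k hk
    rcases lt_or_ge k s with h | h
    · have h1 := toSquareBlock_mul_of_blockTriangular hGu (hupper hM) k
      rwa [hL, toSquareBlock_eq_one hβ hβ' hk (hM.left_one k h),
        toSquareBlock_eq_one hβ hβ' hk (hM'.left_one k h), mul_one, eq_comm] at h1
    · have h1 : (G * rightSquare hm M).toSquareBlock β k =
          G.toSquareBlock β k * (rightSquare hm M).toSquareBlock β k :=
        toSquareBlock_mul_of_blockTriangular hGl (hlower hM) (OrderDual.toDual k)
      rwa [hR, toSquareBlock_eq_one hβ hβ' hk (hM.right_one k h hk),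
        toSquareBlock_eq_one hβ hβ' hk (hM'.right_one k h hk), mul_one, eq_comm] at h1
  ext i j
  rcases lt_trichotomy (β i) (β j) with h | h | h
  · rw [hGl h, one_apply_ne (fun hij => h.ne (congrArg β hij))]
  · have := congrFun (congrFun (hdiag (β j) (hβ j).1) ⟨i, h⟩) ⟨j, rfl⟩
    simpa [toSquareBlock_def, one_apply, Subtype.ext_iff] using this
  · rw [hGu h, one_apply_ne (fun hij => h.ne' (congrArg β hij))]

theorem eq_of_hasNewtonShape [Fact p.Prime] (h0 : A.coeff 0 ≠ 0) {m s : ℕ}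
    (hm : A.natDegree ≤ m)
    {b b' : Module.Basis (Fin A.natDegree) ℤ_[p] (ℤ_[p] ⊗[ℤ] recurrenceModule A m)}
    (h : HasNewtonShape p A hm s (rowMatrix p A m b))
    (h' : HasNewtonShape p A hm s (rowMatrix p A m b')) : b' = b := by
  have hG : Matrix.of (fun i j => b.repr (b' i) j) * rowMatrix p A m b = rowMatrix p A m b' := by
    ext1 i c
    have := congrArg (recurrenceCoord p A m c) (b.sum_repr (b' i))
    simp only [map_sum, map_smul, smul_eq_mul] at this
    simpa only [mul_apply, rowMatrix, of_apply] using this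
  have h1 := eq_one_of_mul_hasNewtonShape h0 hm h h' hG
  refine Module.Basis.eq_of_apply_eq fun i => ?_
  rw [← b.sum_repr (b' i), Finset.sum_eq_single i]
  · have := congrFun (congrFun h1 i) i
    simp only [of_apply, one_apply_eq] at this
    rw [this, one_smul]
  · intro j _ hj
    have := congrFun (congrFun h1 i) j
    simp only [of_apply, one_apply_ne hj.symm] at this
    rw [this, zero_smul]
  · simp

end Uniqueness

theorem existsUnique_basis_hasNewtonShape {p : ℕ} [Fact p.Prime] {A : ℤ[X]}
    (h0 : A.coeff 0 ≠ 0) {m s : ℕ} (hm : A.natDegree ≤ m) (hs : s ≤ newtonEdges p A)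
    (hneg : ∀ k < s, newtonSlope p A k ≤ 0)
    (hpos : ∀ k, s ≤ k → k < newtonEdges p A → 0 ≤ newtonSlope p A k) :
    ∃! b : Module.Basis (Fin A.natDegree) ℤ_[p] (ℤ_[p] ⊗[ℤ] recurrenceModule A m),
      HasNewtonShape p A hm s (rowMatrix p A m b) := by
  obtain ⟨b, hb⟩ := exists_basis_hasNewtonShape h0 hm hs hneg hpos
  exact ⟨b, hb, fun b' hb' => eq_of_hasNewtonShape h0 hm hb hb'⟩

theorem theorem3 (p : ℕ) [Fact p.Prime] (A : Polynomial ℤ) (hA : A.IsPrimitive)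
    (h0 : A.coeff 0 ≠ 0) (m : ℕ) (hm : A.natDegree < m) :
    (∃! b : Module.Basis (Fin A.natDegree) ℤ_[p] (ℤ_[p] ⊗[ℤ] recurrenceModule A m),
      HasNewtonShape p A hm.le (firstNonnegEdge p A) (rowMatrix p A m b)) ∧
    (∃! b : Module.Basis (Fin A.natDegree) ℤ_[p] (ℤ_[p] ⊗[ℤ] recurrenceModule A m),
      HasNewtonShape p A hm.le (firstPosEdge p A) (rowMatrix p A m b)) := by
  constructor
  · have hs : firstNonnegEdge p A ≤ newtonEdges p A := Nat.sInf_le (Or.inl rfl)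
    refine existsUnique_basis_hasNewtonShape h0 hm.le hs (fun k hk => ?_) fun k hk hkr => ?_
    · have : k ∉ _ := Nat.notMem_of_lt_sInf hk
      by_contra! h
      exact this (Or.inr ⟨hk.trans_le hs, h.le⟩)
    · rcases Nat.sInf_mem (s := {k : ℕ | k = newtonEdges p A ∨
          (k < newtonEdges p A ∧ 0 ≤ newtonSlope p A k)}) ⟨_, Or.inl rfl⟩ with h | h
      · exact absurd (h.symm.le.trans hk) (not_le.mpr hkr)
      · exact h.2.trans (newtonSlope_mono h0 hk hkr)
  · have hs : firstPosEdge p A ≤ newtonEdges p A := Nat.sInf_le (Or.inl rfl)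
    refine existsUnique_basis_hasNewtonShape h0 hm.le hs (fun k hk => ?_) fun k hk hkr => ?_
    · have : k ∉ _ := Nat.notMem_of_lt_sInf hk
      by_contra! h
      exact this (Or.inr ⟨hk.trans_le hs, h⟩)
    · rcases Nat.sInf_mem (s := {k : ℕ | k = newtonEdges p A ∨
          (k < newtonEdges p A ∧ 0 < newtonSlope p A k)}) ⟨_, Or.inl rfl⟩ with h | h
      · exact absurd (h.symm.le.trans hk) (not_le.mpr hkr)
      · exact h.2.le.trans (newtonSlope_mono h0 hk hkr)
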